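/- **Definitions.** All sets below live in one fixed universe. A *simply-typed binding arity* over a set $T$ is an expression $\alpha=(t_1^{(\vec u_1)}\times\dots\times t_n^{(\vec u_n)}\to\tau)$ with $n\ge 0$, $t_k,\tau\in T$ and each $\vec u_k$ a finite list of elements of $T$; for $g:T\to T'$ its retyping $g^*\alpha$ is obtained by applying $g$ to all the types in $\alpha$. A *simply-typed signature* $(T,S)$ is a set $T$ with a family $S=(\alpha_i)_{i\in I}$ of such arities over $T$. A morphism $(T,(\alpha_i)_{i\in I})\to(T',(\alpha'_{i'})_{i'\in I'})$ is a pair of functions $g:T\to T'$, $h:I\to I'$ with $\alpha'_{h(i)}=g^*\alpha_i$ for all $i$. This defines the category $\mathrm{STSig}$. A *module signature* on a monoidal category $\mathcal C$ is a functorial assignment $\Sigma$ to each monoid $R$ of $\mathcal C$ of an $R$-module $\Sigma(R)$, monoid morphisms $R\to R'$ being sent to $R$-linear maps from $\Sigma(R)$ to the restriction of $\Sigma(R')$. A *model* of $\Sigma$ is a monoid $R$ with an $R$-linear map $\Sigma(R)\to R$; a morphism of models is a monoid morphism commuting with these maps. In the bicategory $\mathrm{ModSig}$ the objects are pairs $(\mathcal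 C,\Sigma)$; a morphism $(\mathcal C,\Sigma)\to(\mathcal C',\Sigma')$ is a lax monoidal functor $F:\mathcal C\to\mathcal C'$ with $F(R)$-linear maps $\Sigma'(F R)\to F(\Sigma R)$ natural in the monoid $R$; a 2-cell is a monoidal natural transformation compatible with these maps. The *models functor* $\mathrm{Model}:\mathrm{ModSig}\to\mathrm{Cat}$ (a pseudofunctor) sends $(\mathcal C,\Sigma)$ to its category of models, and a morphism $F$ to the functor $(R,\ \Sigma(R)\to R)\mapsto (F R,\ \Sigma'(F R)\to F(\Sigma R)\to F R)$. For $\tau\in T$ let $\mathbf y_\tau:T\to\mathrm{Set}$ send $t$ to $1$ if $t=\tau$ and to $\emptyset$ otherwise. For an endofunctor $R$ of $\mathrm{Set}^T$ and $\vec u=(u_1,\dots,u_n)$ let $R^{(\vec u)}(X)=R(X+\mathbf y_{u_1}+\dots+\mathbf y_{u_n})$. A simply-typed signature $(T,(\alpha_i)_{i\in I})$ determines the module signature on $[\mathrm{Set}^T,\mathrm{Set}^T]$ (whose monoids are the monads on $\mathrm{Set}^T$) $$R\mapsto \coprod_{\alpha_i=(t_1^{(\vec u_1)}\times\dots\times t_n^{(\vec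 u_n)}\to\tau),\ i\in I}\bigl(R^{(\vec u_1)}_{t_1}\times\dots\times R^{(\vec u_n)}_{t_n}\bigr)\cdot\mathbf y_\tau ,$$ with the action of $R$ by capture-avoiding substitution. A morphism $(g,h):(T,S)\to(T',S')$ determines a morphism from the module signature of $(T',S')$ to that of $(T,S)$, whose lax monoidal functor is $F\mapsto \mathrm{Set}^g\circ F\circ\mathrm{Lan}_g$, where $\mathrm{Set}^g$ is precomposition with $g$ and $\mathrm{Lan}_g(X)=\coprod_{t\in T}X_t\cdot\mathbf y_{g(t)}$ is its left adjoint, and whose comparison maps send the $i$-th summand to the $h(i)$-th one. With the canonical isomorphisms $\mathrm{Lan}_{\mathrm{id}}\cong\mathrm{Id}$ and $\mathrm{Lan}_{g'\circ g}\cong\mathrm{Lan}_{g'}\circ\mathrm{Lan}_g$ this is a pseudofunctor $\mathrm{STSig}^{op}\to\mathrm{ModSig}$. **Theorem.** Let $\mathrm{STSigModel}:\mathrm{STSig}^{op}\to\mathrm{Cat}$ be the composite pseudofunctor $\mathrm{STSig}^{op}\to\mathrm{ModSig}\xrightarrow{\mathrm{Model}}\mathrm{Cat}$. 1. $\mathrm{STSigModel}$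 is functorial on the $1$-category $\mathrm{STSig}^{op}$ up to equivalence: there are a strict functor of $1$-categories $F:\mathrm{STSig}^{op}\to\mathrm{Cat}$ and a pseudonatural transformation $F\Rightarrow\mathrm{STSigModel}$ all of whose components are equivalences of categories. 2. For every simply-typed signature $(T,S)$, $\mathrm{STSigModel}(T,S)$ is the category of models of the module signature of $(T,S)$, and this category has an initial object. -/

import Mathlib

open CategoryTheory MonoidalCategory

universe v w u

namespace InitSem

/-- A module signature on a monoidal category `C`: a functorial assignment, to every monoid `R` of `C`,
of a module `obj R` over `R`, in such a way that for a monoid morphism `f : R ⟶ S` the map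
`obj R ⟶ obj S` is a morphism of modules over `f` (that is, an `R`-linear map to the restriction of
`obj S` along `f`). For `C` a category of endofunctors Mathlib's tensor product is
`F ⊗ G = F ⋙ G`, so that `R.X ⊗ M ⟶ M` is the usual substitution `M (R X) ⟶ M X` of a module
over a monad. -/
structure ModuleSignature (C : Type w) [Category.{v} C] [MonoidalCategory C] extends
    Mon C ⥤ C where
  mod (R : Mon C) : ModObj R.X (obj R)
  act_naturality {R S : Mon C} (f : R ⟶ S) :
    ((mod R).smul : R.X ⊗ obj R ⟶ obj R) ≫ map f = (f.hom ⊗ₘ map f) ≫ (mod S).smul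

namespace ModuleSignature

variable {C : Type w} [Category.{v} C] [MonoidalCategory C] (S : ModuleSignature C)

/-- The action `R ⊗ Σ R ⟶ Σ R`. -/
def act (R : Mon C) : R.X ⊗ S.obj R ⟶ S.obj R := (S.mod R).smul

lemma act_nat {R R' : Mon C} (f : R ⟶ R') :
    S.act R ≫ S.map f = (f.hom ⊗ₘ S.map f) ≫ S.act R' := S.act_naturality f

/-- A model of a module signature `Σ`: a monoid `R` with an `R`-linear map `Σ R ⟶ R`, where `R` is
a module over itself by multiplication. -/
structure Model where
  mon : Mon C
  act : S.obj mon ⟶ mon.X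
  linear : S.act mon ≫ act = (mon.X ◁ act) ≫ MonObj.mul

namespace Model
variable {S}

/-- A morphism of models: a monoid morphism commuting with the actions of the signature. -/
@[ext]
structure Hom (M N : S.Model) where
  hom : M.mon ⟶ N.mon
  comm : M.act ≫ hom.hom = S.map hom ≫ N.act

instance : Category S.Model where
  Hom := Hom
  id M := { hom := 𝟙 _, comm := by simp }
  comp f g := { hom := f.hom ≫ g.hom, comm := by simp [reassoc_of% f.comm, g.comm] }

@[ext]
lemma hom_ext {M N : S.Model} {f g : M ⟶ N} (h : f.hom.hom = g.hom.hom) : f = g :=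
  Hom.ext (Mon.Hom.ext h)

@[simp] lemma id_hom (M : S.Model) : (𝟙 M : M ⟶ M).hom = 𝟙 M.mon := rfl
@[simp] lemma comp_hom {M N P : S.Model} (f : M ⟶ N) (g : N ⟶ P) :
    (f ≫ g).hom = f.hom ≫ g.hom := rfl

end Model
end ModuleSignature

/-- Objects of the bicategory of module signatures: a monoidal category with a module signature on it. -/
structure ModSig where
  carrier : Type w
  [cat : Category.{v} carrier]
  [monoidal : MonoidalCategory carrier]
  sig : ModuleSignature carrier

namespace ModSig

attribute [instance] ModSig.cat ModSig.monoidal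

open Functor.LaxMonoidal

/-- A morphism of module signatures: a lax monoidal functor `F` together with maps
`T (F R) ⟶ F (S R)`, natural in the monoid `R` and linear over the monoid `F R`. -/
structure Hom (S T : ModSig.{v, w}) where
  functor : S.carrier ⥤ T.carrier
  [lax : functor.LaxMonoidal]
  app (R : Mon S.carrier) : T.sig.obj (functor.mapMon.obj R) ⟶ functor.obj (S.sig.obj R)
  naturality {R R' : Mon S.carrier} (f : R ⟶ R') :
    T.sig.map (functor.mapMon.map f) ≫ app R' = app R ≫ functor.map (S.sig.map f)
  linear (R : Mon S.carrier) :
    T.sig.act (functor.mapMon.obj R) ≫ app R =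
      (functor.obj R.X ◁ app R) ≫ μ functor R.X (S.sig.obj R) ≫ functor.map (S.sig.act R)

attribute [instance] Hom.lax

/-- A 2-cell: a monoidal natural transformation compatible with the comparison maps. -/
structure Hom₂ {S T : ModSig.{v, w}} (F G : Hom S T) where
  nat : F.functor ⟶ G.functor
  [isMonoidal : NatTrans.IsMonoidal nat]
  comm (R : Mon S.carrier) :
    F.app R ≫ nat.app (S.sig.obj R) =
      T.sig.map ((Functor.mapMonNatTrans nat).app R) ≫ G.app R

attribute [instance] Hom₂.isMonoidal

lemma Hom₂.ext' {S T : ModSig.{v, w}} {F G : Hom S T} {a b : Hom₂ F G} (h : a.nat = b.nat) :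
    a = b := by
  cases a; cases b; cases h; rfl

instance homCat (S T : ModSig.{v, w}) : Category (Hom S T) where
  Hom := Hom₂
  id F :=
    { nat := 𝟙 _
      comm R := by
        have : (Functor.mapMonNatTrans (𝟙 F.functor)).app R = 𝟙 _ := by ext; rfl
        rw [this]; simp }
  comp {F G H} a b :=
    { nat := a.nat ≫ b.nat
      comm R := by
        have : (Functor.mapMonNatTrans (a.nat ≫ b.nat)).app R =
          (Functor.mapMonNatTrans a.nat).app R ≫ (Functor.mapMonNatTrans b.nat).app R := by
          ext; rfl
        rw [this]; simp [reassoc_of% (a.comm R), b.comm R] }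
  id_comp a := Hom₂.ext' (Category.id_comp _)
  comp_id a := Hom₂.ext' (Category.comp_id _)
  assoc a b c := Hom₂.ext' (Category.assoc _ _ _)

@[simp] lemma id_nat {S T : ModSig.{v, w}} (F : Hom S T) : Hom₂.nat (𝟙 F) = 𝟙 F.functor := rfl
@[simp] lemma comp_nat {S T : ModSig.{v, w}} {F G H : Hom S T} (a : F ⟶ G) (b : G ⟶ H) :
    Hom₂.nat (a ≫ b) = Hom₂.nat a ≫ Hom₂.nat b := rfl

@[ext]
lemma hom₂_ext {S T : ModSig.{v, w}} {F G : Hom S T} {a b : F ⟶ G}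
    (h : Hom₂.nat a = Hom₂.nat b) : a = b := Hom₂.ext' h

lemma comp_linear_aux {C : Type*} [Category* C] [MonoidalCategory C] {D : Type*} [Category* D]
    [MonoidalCategory D] (G : C ⥤ D) [G.LaxMonoidal] {A B E E' : C} {P Q : D}
    (a₁ : G.obj A ⊗ P ⟶ P) (m : P ⟶ Q) (a₂ : G.obj A ⊗ Q ⟶ Q) (h₁ : a₁ ≫ m = (𝟙 _ ⊗ₘ m) ≫ a₂)
    (b : A ⊗ B ⟶ B) (g : Q ⟶ G.obj B) (h₂ : a₂ ≫ g = (G.obj A ◁ g) ≫ μ G A B ≫ G.map b)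
    (f : B ⟶ E) (e₁ : A ⊗ E ⟶ E') (e₂ : E' ⟶ E) (h₃ : b ≫ f = (A ◁ f) ≫ e₁ ≫ e₂) :
    a₁ ≫ m ≫ g ≫ G.map f =
      (G.obj A ◁ (m ≫ g ≫ G.map f)) ≫ (μ G A E ≫ G.map e₁) ≫ G.map e₂ := by
  rw [reassoc_of% h₁, reassoc_of% h₂, ← G.map_comp, h₃]
  simp

/-- The identity morphism of a module signature. -/
@[simps]
def Hom.id (S : ModSig.{v, w}) : Hom S S where
  functor := 𝟭 _
  app R := S.sig.map (Functor.mapMonIdIso.hom.app R)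
  naturality f := by
    refine (S.sig.map_comp _ _).symm.trans (Eq.trans ?_ (S.sig.map_comp _ _))
    exact congrArg S.sig.map (Functor.mapMonIdIso.hom.naturality f)
  linear R := by
    refine (S.sig.act_nat (Functor.mapMonIdIso.hom.app R)).trans ?_
    have h : ∀ {X P Q : S.carrier} (m : P ⟶ Q) (a : X ⊗ Q ⟶ Q),
      (𝟙 X ⊗ₘ m) ≫ a = (X ◁ m) ≫ 𝟙 _ ≫ a := by simp
    exact h _ _

/-- Composition of morphisms of module signatures. -/
@[simps]
def Hom.comp {S T U : ModSig.{v, w}} (F : Hom S T) (G : Hom T U) : Hom S U where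
  functor := F.functor ⋙ G.functor
  app R := U.sig.map (Functor.mapMonCompIso.hom.app R) ≫ G.app (F.functor.mapMon.obj R) ≫
    G.functor.map (F.app R)
  naturality {R R'} f := by
    have h₁ := G.naturality (F.functor.mapMon.map f)
    have h₂ := F.naturality f
    have h₀ : U.sig.map ((F.functor ⋙ G.functor).mapMon.map f) ≫
        U.sig.map (Functor.mapMonCompIso.hom.app R') =
        U.sig.map (Functor.mapMonCompIso.hom.app R) ≫
        U.sig.map (G.functor.mapMon.map (F.functor.mapMon.map f)) := by
      refine (U.sig.map_comp _ _).symm.trans (Eq.trans ?_ (U.sig.map_comp _ _))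
      exact congrArg U.sig.map (Functor.mapMonCompIso.hom.naturality f)
    rw [reassoc_of% h₀, reassoc_of% h₁, ← G.functor.map_comp, h₂]
    simp
  linear R :=
    comp_linear_aux G.functor _ _ _ (U.sig.act_nat (Functor.mapMonCompIso.hom.app R))
      _ _ (G.linear (F.functor.mapMon.obj R)) _ _ _ (F.linear R)

lemma sig_map_comp_eq (S : ModSig.{v, w}) {M N N' P : Mon S.carrier} {f : M ⟶ N} {g : N ⟶ P}
    {f' : M ⟶ N'} {g' : N' ⟶ P} (h : f.hom ≫ g.hom = f'.hom ≫ g'.hom) :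
    S.sig.map f ≫ S.sig.map g = S.sig.map f' ≫ S.sig.map g' := by
  rw [← S.sig.map_comp, ← S.sig.map_comp]
  exact congrArg S.sig.map (Mon.Hom.ext h)

lemma sig_map_comp_eq₃ (S : ModSig.{v, w}) {M N N' N'' P : Mon S.carrier} {f : M ⟶ N} {g : N ⟶ P}
    {f' : M ⟶ N'} {g' : N' ⟶ N''} {k' : N'' ⟶ P}
    (h : f.hom ≫ g.hom = f'.hom ≫ g'.hom ≫ k'.hom) :
    S.sig.map f ≫ S.sig.map g = S.sig.map f' ≫ S.sig.map g' ≫ S.sig.map k' := by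
  rw [← S.sig.map_comp, ← S.sig.map_comp, ← S.sig.map_comp]
  exact congrArg S.sig.map (Mon.Hom.ext h)

lemma whisker_aux {C : Type*} [Category* C] {P Q Q' N B B' E E' : C} {c : P ⟶ Q} {m : Q ⟶ N}
    {m' : P ⟶ Q'} {c' : Q' ⟶ N} (h₀ : c ≫ m = m' ≫ c') {g : Q ⟶ B} {y : B ⟶ B'} {h : N ⟶ B'}
    (h₁ : m ≫ h = g ≫ y) {k : B ⟶ E} {z : E ⟶ E'} {l : B' ⟶ E'} (h₂ : k ≫ z = y ≫ l) :
    (c ≫ g ≫ k) ≫ z = m' ≫ c' ≫ h ≫ l := by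
  rw [← reassoc_of% h₀, reassoc_of% h₁, ← h₂]
  simp

def whiskerLeft {S T U : ModSig.{v, w}} (F : Hom S T) {G H : Hom T U} (b : Hom₂ G H) :
    Hom₂ (F.comp G) (F.comp H) where
  nat := Functor.whiskerLeft F.functor b.nat
  isMonoidal := inferInstanceAs (NatTrans.IsMonoidal (Functor.whiskerLeft F.functor b.nat))
  comm R := whisker_aux
    (sig_map_comp_eq U ((Category.id_comp _).trans (Category.comp_id _).symm))
    (b.comm (F.functor.mapMon.obj R)).symm (b.nat.naturality (F.app R))

def whiskerRight {S T U : ModSig.{v, w}} {F G : Hom S T} (a : Hom₂ F G) (H : Hom T U) :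
    Hom₂ (F.comp H) (G.comp H) where
  nat := Functor.whiskerRight a.nat H.functor
  isMonoidal := inferInstanceAs (NatTrans.IsMonoidal (Functor.whiskerRight a.nat H.functor))
  comm R := whisker_aux
    (sig_map_comp_eq U ((Category.id_comp _).trans (Category.comp_id _).symm))
    (H.naturality ((Functor.mapMonNatTrans a.nat).app R))
    ((H.functor.map_comp _ _).symm.trans
      ((congrArg H.functor.map (a.comm R)).trans (H.functor.map_comp _ _)))

/-- Invertible 2-cells from monoidal natural isomorphisms. -/
def isoMk {S T : ModSig.{v, w}} {F G : Hom S T} (e : F.functor ≅ G.functor)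
    (he : NatTrans.IsMonoidal e.hom)
    (h : ∀ R : Mon S.carrier, F.app R ≫ e.hom.app (S.sig.obj R) =
      T.sig.map ((Functor.mapMonNatTrans e.hom).app R) ≫ G.app R) : F ≅ G where
  hom := { nat := e.hom, comm := h }
  inv :=
    { nat := e.inv
      comm R := by
        have h₀ : T.sig.map ((Functor.mapMonNatTrans e.inv).app R) ≫
            T.sig.map ((Functor.mapMonNatTrans e.hom).app R) = 𝟙 _ := by
          rw [← T.sig.map_comp, ← T.sig.map_id]
          exact congrArg T.sig.map (Mon.Hom.ext (e.inv_hom_id_app R.X))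
        rw [← cancel_mono (e.hom.app (S.sig.obj R)), Category.assoc, Category.assoc, h R,
          reassoc_of% h₀, e.inv_hom_id_app, Category.comp_id] }
  hom_inv_id := Hom₂.ext' e.hom_inv_id
  inv_hom_id := Hom₂.ext' e.inv_hom_id

lemma associator_aux {C D : Type*} [Category* C] [Category* D] (H : C ⥤ D)
    {P₁ P₂ P₃ P₄ P₅ : D} {A A' B E : C} {c₁ : P₁ ⟶ P₂} {x : P₂ ⟶ P₃} {n : P₁ ⟶ P₄} {c₃ : P₄ ⟶ P₅}
    {c₄ : P₅ ⟶ P₃} (h₀ : c₁ ≫ x = n ≫ c₃ ≫ c₄) {h : P₃ ⟶ H.obj A} {h' : P₂ ⟶ H.obj A'}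
    {y : A' ⟶ A} (h₁ : x ≫ h = h' ≫ H.map y) (g : A ⟶ B) (f : B ⟶ E) :
    (c₁ ≫ h' ≫ H.map (y ≫ g ≫ f)) ≫ 𝟙 _ = n ≫ c₃ ≫ (c₄ ≫ h ≫ H.map g) ≫ H.map f := by
  simp only [H.map_comp, Category.assoc, Category.comp_id]
  rw [← reassoc_of% h₁, reassoc_of% h₀]

def associator {S T U V : ModSig.{v, w}} (F : Hom S T) (G : Hom T U) (H : Hom U V) :
    (F.comp G).comp H ≅ F.comp (G.comp H) :=
  isoMk (Functor.associator F.functor G.functor H.functor)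
    (inferInstanceAs
      (NatTrans.IsMonoidal (Functor.associator F.functor G.functor H.functor).hom))
    (fun R => associator_aux H.functor
      (sig_map_comp_eq₃ V ((Category.id_comp _).trans ((H.functor.map_id _).trans
        ((Category.id_comp _).trans (Category.id_comp _)).symm)))
      (H.naturality (Functor.mapMonCompIso.hom.app R)) _ _)

def leftUnitor {S T : ModSig.{v, w}} (F : Hom S T) : (Hom.id S).comp F ≅ F :=
  isoMk F.functor.leftUnitor
    (inferInstanceAs (NatTrans.IsMonoidal F.functor.leftUnitor.hom))
    (fun R => by
      have h := F.naturality (Functor.mapMonIdIso.hom.app R)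
      refine (Category.comp_id _).trans ((congrArg (_ ≫ ·) h.symm).trans ?_)
      refine (Category.assoc _ _ _).symm.trans (congrArg (· ≫ _) ?_)
      refine (T.sig.map_comp _ _).symm.trans (congrArg T.sig.map (Mon.Hom.ext ?_))
      exact (Category.id_comp _).trans (F.functor.map_id _))

def rightUnitor {S T : ModSig.{v, w}} (F : Hom S T) : F.comp (Hom.id T) ≅ F :=
  isoMk F.functor.rightUnitor
    (inferInstanceAs (NatTrans.IsMonoidal F.functor.rightUnitor.hom))
    (fun R => by
      refine (Category.comp_id _).trans ((Category.assoc _ _ _).symm.trans ?_)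
      refine congrArg (· ≫ _) ?_
      refine (T.sig.map_comp _ _).symm.trans (congrArg T.sig.map (Mon.Hom.ext ?_))
      exact Category.id_comp _)

/-- The bicategory of module signatures. -/
instance : Bicategory ModSig.{v, w} where
  Hom := Hom
  id := Hom.id
  comp := Hom.comp
  homCategory := homCat
  whiskerLeft F _ _ b := whiskerLeft F b
  whiskerRight a H := whiskerRight a H
  associator := associator
  leftUnitor := leftUnitor
  rightUnitor := rightUnitor
  whiskerLeft_id _ _ := Hom₂.ext' (Functor.whiskerLeft_id' _)
  whiskerLeft_comp _ _ _ _ _ _ := Hom₂.ext' (Functor.whiskerLeft_comp _ _ _)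
  id_whiskerRight _ _ := Hom₂.ext' (Functor.whiskerRight_id' _)
  comp_whiskerRight _ _ _ := Hom₂.ext' (Functor.whiskerRight_comp _ _ _)
  id_whiskerLeft _ := Hom₂.ext' (NatTrans.ext (funext fun _ =>
    ((Category.id_comp _).trans (Category.comp_id _)).symm))
  comp_whiskerLeft _ _ _ _ _ := Hom₂.ext' (NatTrans.ext (funext fun _ =>
    ((Category.id_comp _).trans (Category.comp_id _)).symm))
  whiskerRight_id _ := Hom₂.ext' (NatTrans.ext (funext fun _ =>
    ((Category.id_comp _).trans (Category.comp_id _)).symm))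
  whiskerRight_comp _ _ _ := Hom₂.ext' (NatTrans.ext (funext fun _ =>
    ((Category.id_comp _).trans (Category.comp_id _)).symm))
  whisker_assoc _ _ _ _ _ := Hom₂.ext' (NatTrans.ext (funext fun _ =>
    ((Category.id_comp _).trans (Category.comp_id _)).symm))
  whisker_exchange _ b := Hom₂.ext' (NatTrans.ext (funext fun _ =>
    (b.nat.naturality _).symm))
  pentagon _ _ _ k := Hom₂.ext' (NatTrans.ext (funext fun _ =>
    (Category.assoc _ _ _).symm.trans ((Category.comp_id _).trans
      (congrArg (· ≫ _) (k.functor.map_id _)))))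
  triangle _ g := Hom₂.ext' (NatTrans.ext (funext fun _ =>
    (Category.id_comp _).trans (g.functor.map_id _).symm))

end ModSig

namespace Model

open ModSig Functor.LaxMonoidal

variable {S T : ModSig.{v, w}}

/-- The category of models of an object of `ModSig`. -/
abbrev _root_.InitSem.ModSig.Model (S : ModSig.{v, w}) := S.sig.Model

/-- The image of a model `(R, a : S R ⟶ R)` under `F`: the monoid `F R` with the operation
`T (F R) ⟶ F (S R) ⟶ F R`. -/
def pushObj (F : ModSig.Hom S T) (M : S.Model) : T.Model where
  mon := F.functor.mapMon.obj M.mon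
  act := F.app M.mon ≫ F.functor.map M.act
  linear := by
    have h : ∀ {C D : Type w} [Category.{v} C] [Category.{v} D] [MonoidalCategory C]
        [MonoidalCategory D] (F : C ⥤ D) [F.LaxMonoidal] {R A : C} {P : D}
        (t : F.obj R ⊗ P ⟶ P) (s : R ⊗ A ⟶ A) (f : P ⟶ F.obj A) (a : A ⟶ R) (m : R ⊗ R ⟶ R)
        (_ : t ≫ f = (F.obj R ◁ f) ≫ μ F R A ≫ F.map s) (_ : s ≫ a = (R ◁ a) ≫ m),
        t ≫ f ≫ F.map a = (F.obj R ◁ (f ≫ F.map a)) ≫ μ F R R ≫ F.map m := by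
      intro C D _ _ _ _ F _ R A P t s f a m h₁ h₂
      rw [reassoc_of% h₁, ← F.map_comp, h₂]
      simp
    exact h F.functor _ _ _ _ _ (F.linear M.mon) M.linear

/-- The functor between categories of models induced by a morphism of module signatures. -/
@[simps]
def pushforward (F : ModSig.Hom S T) : S.Model ⥤ T.Model where
  obj := pushObj F
  map {M N} f :=
    { hom := F.functor.mapMon.map f.hom
      comm := by
        have h₁ := F.naturality f.hom
        have h₂ : F.functor.map M.act ≫ F.functor.map f.hom.hom =
          F.functor.map (S.sig.map f.hom) ≫ F.functor.map N.act := by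
          rw [← F.functor.map_comp, ← F.functor.map_comp, f.comm]
        refine (Category.assoc _ _ _).trans ((congrArg (_ ≫ ·) h₂).trans ?_)
        exact ((Category.assoc _ _ _).symm.trans (congrArg (· ≫ _) h₁.symm)).trans
          (Category.assoc _ _ _) }
  map_id M := ModuleSignature.Model.hom_ext (F.functor.map_id _)
  map_comp f g := ModuleSignature.Model.hom_ext (F.functor.map_comp _ _)

/-- The natural transformation induced by a 2-cell. -/
def pushNat {F G : ModSig.Hom S T} (a : ModSig.Hom₂ F G) : pushforward F ⟶ pushforward G where
  app M :=
    { hom := (Functor.mapMonNatTrans a.nat).app M.mon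
      comm := by
        refine (Category.assoc _ _ _).trans ((congrArg (_ ≫ ·) (a.nat.naturality M.act)).trans ?_)
        exact ((Category.assoc _ _ _).symm.trans (congrArg (· ≫ _) (a.comm M.mon))).trans
          (Category.assoc _ _ _) }
  naturality M N f := ModuleSignature.Model.hom_ext (a.nat.naturality f.hom.hom)

@[simps]
def mkIso {M N : T.Model} (e : M.mon ≅ N.mon)
    (h : M.act ≫ e.hom.hom = T.sig.map e.hom ≫ N.act) : M ≅ N where
  hom := { hom := e.hom, comm := h }
  inv :=
    { hom := e.inv
      comm := by
        have h₀ : e.hom.hom ≫ e.inv.hom = 𝟙 _ := congrArg Mon.Hom.hom e.hom_inv_id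
        rw [← cancel_epi (T.sig.map e.hom), ← reassoc_of% h, h₀, ← Category.assoc,
          ← T.sig.map_comp, e.hom_inv_id]
        simp }
  hom_inv_id := ModuleSignature.Model.Hom.ext e.hom_inv_id
  inv_hom_id := ModuleSignature.Model.Hom.ext e.inv_hom_id

def pushId (S : ModSig.{v, w}) : pushforward (ModSig.Hom.id S) ≅ 𝟭 _ :=
  NatIso.ofComponents
    (fun M => mkIso (Functor.mapMonIdIso.app M.mon) (Category.comp_id _))
    (fun _ => ModuleSignature.Model.hom_ext ((Category.comp_id _).trans (Category.id_comp _).symm))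

def pushComp {U : ModSig.{v, w}} (F : ModSig.Hom S T) (G : ModSig.Hom T U) :
    pushforward (F.comp G) ≅ pushforward F ⋙ pushforward G :=
  NatIso.ofComponents
    (fun M => mkIso (Functor.mapMonCompIso.app M.mon) (by
      refine (Category.comp_id _).trans ((Category.assoc _ _ _).trans (congrArg (_ ≫ ·) ?_))
      refine (Category.assoc _ _ _).trans (congrArg (_ ≫ ·) ?_)
      exact (G.functor.map_comp _ _).symm))
    (fun _ => ModuleSignature.Model.hom_ext ((Category.comp_id _).trans (Category.id_comp _).symm))

end Model

section

open Model

/-- The models functor, sending a module signature to its category of models. -/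
def models : Pseudofunctor ModSig.{v, w} Cat.{v, max v w} where
  obj S := Cat.of S.Model
  map F := (pushforward F).toCatHom
  map₂ a := (pushNat a).toCatHom₂
  map₂_id _ := Cat.Hom₂.ext (NatTrans.ext (funext fun _ => ModuleSignature.Model.hom_ext rfl))
  map₂_comp _ _ := Cat.Hom₂.ext (NatTrans.ext (funext fun _ => ModuleSignature.Model.hom_ext rfl))
  mapId S := Cat.Hom.isoMk (pushId S)
  mapComp F G := Cat.Hom.isoMk (pushComp F G)
  map₂_whisker_left _ _ _ _ :=
    Cat.Hom₂.ext (NatTrans.ext (funext fun _ => ModuleSignature.Model.hom_ext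
      ((Category.id_comp _).trans (Category.comp_id _)).symm))
  map₂_whisker_right _ _ :=
    Cat.Hom₂.ext (NatTrans.ext (funext fun _ => ModuleSignature.Model.hom_ext
      ((Category.id_comp _).trans (Category.comp_id _)).symm))
  map₂_associator F G H :=
    Cat.Hom₂.ext (NatTrans.ext (funext fun M => ModuleSignature.Model.hom_ext (by
      have h : 𝟙 (H.functor.obj (G.functor.obj (F.functor.obj M.mon.X))) =
        𝟙 _ ≫ H.functor.map (𝟙 _) ≫ 𝟙 _ ≫ 𝟙 _ ≫ 𝟙 _ := by simp
      exact h)))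
  map₂_left_unitor F :=
    Cat.Hom₂.ext (NatTrans.ext (funext fun _ => ModuleSignature.Model.hom_ext
      ((Category.id_comp _).trans ((congrArg (· ≫ _) (F.functor.map_id _)).trans
        (Category.id_comp _))).symm))
  map₂_right_unitor F :=
    Cat.Hom₂.ext (NatTrans.ext (funext fun M => ModuleSignature.Model.hom_ext (by
      have h : 𝟙 (F.functor.obj M.mon.X) = 𝟙 _ ≫ 𝟙 _ ≫ 𝟙 _ := by simp
      exact h)))


end

section Conjugation

open Functor.LaxMonoidal

attribute [local instance] endofunctorMonoidalCategory

variable {C : Type*} [Category* C] {D : Type*} [Category* D] {L : C ⥤ D} {R : D ⥤ C}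

/-- The functor `F ↦ R ∘ F ∘ L` between categories of endofunctors. -/
@[simps]
def conj (L : C ⥤ D) (R : D ⥤ C) : (D ⥤ D) ⥤ (C ⥤ C) where
  obj F := L ⋙ F ⋙ R
  map a := Functor.whiskerLeft L (Functor.whiskerRight a R)

lemma map_map_sq {C D E : Type*} [Category* C] [Category* D] [Category* E] (G : C ⥤ D) (R : D ⥤ E)
    {X Y Y' Z : C} {a : X ⟶ Y} {b : Y ⟶ Z} {c : X ⟶ Y'} {d : Y' ⟶ Z} (h : a ≫ b = c ≫ d) :
    R.map (G.map a) ≫ R.map (G.map b) = R.map (G.map c) ≫ R.map (G.map d) := by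
  rw [← R.map_comp, ← R.map_comp, ← G.map_comp, ← G.map_comp, h]

lemma map_sq {D E : Type*} [Category* D] [Category* E] (R : D ⥤ E)
    {X Y Y' Z : D} {a : X ⟶ Y} {b : Y ⟶ Z} {c : X ⟶ Y'} {d : Y' ⟶ Z} (h : a ≫ b = c ≫ d) :
    R.map a ≫ R.map b = R.map c ≫ R.map d := by
  rw [← R.map_comp, ← R.map_comp, h]

/-- For an adjunction `L ⊣ R` the functor `F ↦ R ∘ F ∘ L` is lax monoidal, through
`1 ⟶ R L` and `R F L R G L ⟶ R F G L`. -/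
@[reducible]
def conjLax (adj : L ⊣ R) : (conj L R).LaxMonoidal where
  ε := adj.unit
  μ F G :=
    { app X := R.map (G.map (adj.counit.app (F.obj (L.obj X))))
      naturality _ _ f := map_map_sq G R (adj.counit.naturality (F.map (L.map f))) }
  μ_natural_left f G := NatTrans.ext (funext fun X =>
    map_map_sq G R (adj.counit.naturality (f.app (L.obj X))))
  μ_natural_right {G G'} F f := NatTrans.ext (funext fun X =>
    (map_sq R (f.naturality (adj.counit.app (F.obj (L.obj X))))).symm)
  associativity F G H := NatTrans.ext (funext fun X => by
    have h := map_map_sq H R (adj.counit.naturality (G.map (adj.counit.app (F.obj (L.obj X)))))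
    have h' := (congrArg (_ ≫ ·) ((congrArg (_ ≫ ·) (R.map_id _)).trans (Category.comp_id _))).trans
      (h.trans (Category.id_comp _).symm)
    exact h')
  left_unitality F := NatTrans.ext (funext fun X => by
    have h := congrArg (fun k => R.map (F.map k)) (adj.left_triangle_components X)
    simp only [Functor.map_comp] at h
    rw [F.map_id, R.map_id] at h
    have h' := (h.symm.trans (Category.comp_id _).symm).trans
      ((Category.assoc _ _ _).trans (congrArg (fun k => _ ≫ _ ≫ k) (R.map_id _).symm))
    exact h')
  right_unitality F := NatTrans.ext (funext fun X => by
    have h := adj.right_triangle_components (F.obj (L.obj X))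
    have h' := (h.symm.trans (Category.comp_id _).symm).trans
      ((Category.assoc _ _ _).trans (congrArg (fun k => _ ≫ _ ≫ k) (R.map_id _).symm))
    exact h')

end Conjugation

/-- The category of families of sets indexed by `T`, that is, of functors from the discrete
category `T` to sets. -/
def Ctx (T : Type u) : Type (u + 1) := T → Type u

instance (T : Type u) : Category.{u} (Ctx T) := inferInstanceAs (Category.{u} (∀ _ : T, Type u))

/-- Finite lists `(u₁, …, uₙ)` of elements of `T`. -/
structure Word (T : Type u) : Type u where
  length : ℕ
  get : Fin length → T

/-- Apply `g` to every letter. -/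
def Word.map {T T' : Type u} (g : T → T') (w : Word T) : Word T' := ⟨w.length, fun k => g (w.get k)⟩

/-- Simply-typed binding arities `t₁^(u₁) × … × tₙ^(uₙ) → τ` over `T`, where each `uᵢ` is a list of
types: `args` is the list of the pairs `(uᵢ, tᵢ)` and `target` is `τ`. -/
structure BindingArity (T : Type u) : Type u where
  args : Word (Word T × T)
  target : T

/-- Retyping of an arity along `g`. -/
def BindingArity.retype {T T' : Type u} (g : T → T') (α : BindingArity T) : BindingArity T' where
  args := α.args.map (fun a => (a.1.map g, g a.2))
  target := g α.target

/-- Simply-typed binding signatures: a set `ty` of types and a family of binding arities over it,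
indexed by a set `label`. -/
structure STSig : Type (u + 1) where
  ty : Type u
  label : Type u
  arity : label → BindingArity ty

namespace STSig

/-- Morphisms of simply-typed signatures: maps on types and on labels, compatible with the arities. -/
@[ext]
structure Hom (S S' : STSig.{u}) where
  onTy : S.ty → S'.ty
  onLabel : S.label → S'.label
  arity_eq (i : S.label) : S'.arity (onLabel i) = (S.arity i).retype onTy

instance : Category STSig.{u} where
  Hom := Hom
  id S := ⟨id, id, fun _ => rfl⟩
  comp f g := ⟨g.onTy ∘ f.onTy, g.onLabel ∘ f.onLabel, fun i =>
    (g.arity_eq (f.onLabel i)).trans (congrArg (BindingArity.retype g.onTy) (f.arity_eq i))⟩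

end STSig

variable {T T' : Type u}

lemma ctx_ext {X Y : Ctx T} {f g : X ⟶ Y} (h : ∀ t x, f t x = g t x) : f = g :=
  funext fun t => by ext x; exact h t x

lemma ctx_congr {X Y : Ctx T} {f g : X ⟶ Y} (h : f = g) (t : T) (x : X t) : f t x = g t x := by
  rw [h]

/-- The family with one element over `τ` and none elsewhere. -/
def yo (τ : T) : Ctx T := fun t => ULift.{u} (PLift (t = τ))

instance (τ t : T) : Subsingleton (yo τ t) := inferInstanceAs (Subsingleton (ULift (PLift _)))

/-- The family `y_{u₁} + … + y_{uₙ}` of variables bound by a word. -/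
def bound (w : Word T) : Ctx T := fun t => Σ k : Fin w.length, yo (w.get k) t

/-- Context extension `X ↦ X + y_{u₁} + … + y_{uₙ}`. -/
def ext (w : Word T) : Ctx T ⥤ Ctx T where
  obj X := fun t => X t ⊕ bound w t
  map f := fun t => ↾(Sum.map (f t) id)
  map_id _ := ctx_ext fun _ x => by cases x <;> rfl
  map_comp _ _ := ctx_ext fun _ x => by cases x <;> rfl

/-- Left Kan extension along `g`, given by `X ↦ ∐ₜ Xₜ · y_{g t}`. -/
def lan (g : T → T') : Ctx T ⥤ Ctx T' where
  obj X := fun t' => Σ t : T, X t × yo (g t) t'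
  map f := fun _ => ↾(fun x => ⟨x.1, f x.1 x.2.1, x.2.2⟩)
  map_id _ := ctx_ext fun _ _ => rfl
  map_comp _ _ := ctx_ext fun _ _ => rfl

/-- Precomposition with `g`. -/
def res (g : T → T') : Ctx T' ⥤ Ctx T where
  obj Y := fun t => Y (g t)
  map f := fun t => f (g t)
  map_id _ := ctx_ext fun _ _ => rfl
  map_comp _ _ := ctx_ext fun _ _ => rfl

/-- Left Kan extension is left adjoint to precomposition. -/
def lanAdj (g : T → T') : lan g ⊣ res g :=
  Adjunction.mkOfUnitCounit
   { unit :=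
      { app _ := fun t => ↾(fun x => ⟨t, x, ⟨⟨rfl⟩⟩⟩)
        naturality _ _ _ := ctx_ext fun _ _ => rfl }
     counit :=
      { app Y := fun _ => ↾(fun x => cast (congrArg Y x.2.2.down.down.symm) x.2.1)
        naturality X Y f := ctx_ext fun t' x => by
          obtain ⟨t, x, ⟨⟨e⟩⟩⟩ := x
          subst e
          rfl }
     left_triangle := NatTrans.ext (funext fun X => ctx_ext fun t' x => by
      obtain ⟨t, x, ⟨⟨e⟩⟩⟩ := x
      subst e
      rfl)
     right_triangle := NatTrans.ext (funext fun X => ctx_ext fun t' x => rfl) }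

/-- The value `(P_{u₁} t₁ × … × P_{uₙ} tₙ) · y_τ` of an arity, for a family `P` indexed by words. -/
def BindingArity.val (P : Word T → Ctx T) (α : BindingArity T) : Ctx T := fun t =>
  (∀ k : Fin α.args.length, P (α.args.get k).1 (α.args.get k).2) × yo α.target t

/-- The coproduct of the values of all the arities of a signature. -/
def opsObj (S : STSig.{u}) (P : Word S.ty → Ctx S.ty) : Ctx S.ty := fun t =>
  Σ i : S.label, (S.arity i).val P t

def opsMap (S : STSig.{u}) {P Q : Word S.ty → Ctx S.ty} (φ : ∀ w, P w ⟶ Q w) :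
    opsObj S P ⟶ opsObj S Q := fun _ =>
  ↾(fun x => ⟨x.1, (fun k => φ _ _ (x.2.1 k), x.2.2)⟩)

section

variable (S : STSig.{u}) {P Q Q' P' : Word S.ty → Ctx S.ty}

lemma opsMap_id {φ : ∀ w, P w ⟶ P w} (h : ∀ w, φ w = 𝟙 _) : opsMap S φ = 𝟙 _ := by
  obtain rfl : φ = fun w => 𝟙 _ := funext h
  rfl

lemma opsMap_comp (φ : ∀ w, P w ⟶ Q w) (ψ : ∀ w, Q w ⟶ P' w) {χ : ∀ w, P w ⟶ P' w}
    (h : ∀ w, φ w ≫ ψ w = χ w) : opsMap S φ ≫ opsMap S ψ = opsMap S χ := by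
  obtain rfl : _ = χ := funext h
  rfl

lemma opsMap_sq {a : ∀ w, P w ⟶ Q w} {b : ∀ w, Q w ⟶ P' w} {c : ∀ w, P w ⟶ Q' w}
    {d : ∀ w, Q' w ⟶ P' w} (h : ∀ w, a w ≫ b w = c w ≫ d w) :
    opsMap S a ≫ opsMap S b = opsMap S c ≫ opsMap S d :=
  (opsMap_comp S a b h).trans (opsMap_comp S c d (fun _ => rfl)).symm

end

/-- The endofunctor `⊔ᵢ (F^(u₁)_{t₁} × … × F^(uₙ)_{tₙ}) · y_τ` associated with an endofunctor `F`,
where `F^(u) X = F (X + y_{u₁} + … + y_{uₖ})`. -/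
def sigObj (S : STSig.{u}) (F : Ctx S.ty ⥤ Ctx S.ty) : Ctx S.ty ⥤ Ctx S.ty where
  obj X := opsObj S (fun w => F.obj ((ext w).obj X))
  map f := opsMap S (fun w => F.map ((ext w).map f))
  map_id X := opsMap_id S (fun w => by simp)
  map_comp f g := (opsMap_comp S _ _ (fun w => by simp)).symm

/-- Functoriality of `sigObj` in the endofunctor. -/
def sigFunctor (S : STSig.{u}) : (Ctx S.ty ⥤ Ctx S.ty) ⥤ (Ctx S.ty ⥤ Ctx S.ty) where
  obj F := sigObj S F
  map a :=
    { app X := opsMap S (fun w => a.app ((ext w).obj X))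
      naturality _ _ _ := opsMap_sq S (fun _ => a.naturality _) }
  map_id F := NatTrans.ext (funext fun X => opsMap_id S (fun w => rfl))
  map_comp f g := NatTrans.ext (funext fun X =>
    (opsMap_comp S (fun w => f.app ((ext w).obj X)) (fun w => g.app ((ext w).obj X))
      (fun w => rfl)).symm)

section

@[reducible]
def endoStruct (C : Type*) [Category* C] : MonoidalCategoryStruct (C ⥤ C) :=
  (endofunctorMonoidalCategory C).toMonoidalCategoryStruct

attribute [local instance] endofunctorMonoidalCategory
attribute [local instance] endoStruct

open MonObj

section

variable {C : Type w} [Category.{v} C] (R R' : Mon (C ⥤ C))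

/-- The unit of a monad at `X`. -/
def unitAt (X : C) : X ⟶ R.X.obj X := (one (X := R.X)).app X

/-- The multiplication of a monad at `X`. -/
def multAt (X : C) : R.X.obj (R.X.obj X) ⟶ R.X.obj X := (mul (X := R.X)).app X

lemma unitAt_naturality {X Y : C} (f : X ⟶ Y) :
    f ≫ unitAt R Y = unitAt R X ≫ R.X.map f := (one (X := R.X)).naturality f

lemma multAt_naturality {X Y : C} (f : X ⟶ Y) :
    R.X.map (R.X.map f) ≫ multAt R Y = multAt R X ≫ R.X.map f := (mul (X := R.X)).naturality f

lemma map_unitAt_multAt (X : C) : R.X.map (unitAt R X) ≫ multAt R X = 𝟙 _ :=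
  congrArg (fun a => NatTrans.app a X) (one_mul R.X)

lemma unitAt_multAt (X : C) : unitAt R (R.X.obj X) ≫ multAt R X = 𝟙 _ :=
  congrArg (fun a => NatTrans.app a X) (mul_one R.X)

lemma map_multAt_multAt (X : C) :
    R.X.map (multAt R X) ≫ multAt R X = multAt R (R.X.obj X) ≫ multAt R X :=
  (congrArg (fun a => NatTrans.app a X) (mul_assoc R.X)).trans (Category.id_comp _)

variable {R R'}

lemma unitAt_hom (f : R ⟶ R') (X : C) : unitAt R X ≫ f.hom.app X = unitAt R' X :=
  congrArg (fun a => NatTrans.app a X) (IsMonHom.one_hom f.hom)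

lemma multAt_hom (f : R ⟶ R') (X : C) :
    multAt R X ≫ f.hom.app X = f.hom.app (R.X.obj X) ≫ R'.X.map (f.hom.app X) ≫ multAt R' X :=
  (congrArg (fun a => NatTrans.app a X) (IsMonHom.mul_hom f.hom)).trans (Category.assoc _ _ _)

end

/-- The inclusion of `X` in its extension by a word. -/
def inlHom (w : Word T) (X : Ctx T) : X ⟶ (ext w).obj X := fun _ => ↾Sum.inl

/-- The canonical map `R X + y_u ⟶ R (X + y_u)`, given by `R` of the inclusion and by the unit of
`R`; it is used to substitute under binders. -/
def strength (R : Mon (Ctx T ⥤ Ctx T)) (w : Word T) (X : Ctx T) :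
    (ext w).obj (R.X.obj X) ⟶ R.X.obj ((ext w).obj X) := fun t =>
  ↾(Sum.elim (R.X.map (inlHom w X) t) (fun b => unitAt R ((ext w).obj X) t (Sum.inr b)))

lemma ext_hom_ext {w : Word T} {X Y : Ctx T} {f g : (ext w).obj X ⟶ Y}
    (h₁ : inlHom w X ≫ f = inlHom w X ≫ g)
    (h₂ : ∀ t (b : bound w t), f t (Sum.inr b) = g t (Sum.inr b)) : f = g :=
  ctx_ext fun t x => match x with
    | Sum.inl x => ctx_congr h₁ t x
    | Sum.inr b => h₂ t b

lemma inlHom_strength (R : Mon (Ctx T ⥤ Ctx T)) (w : Word T) (X : Ctx T) :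
    inlHom w _ ≫ strength R w X = R.X.map (inlHom w X) := rfl

lemma inlHom_naturality (w : Word T) {X Y : Ctx T} (f : X ⟶ Y) :
    f ≫ inlHom w Y = inlHom w X ≫ (ext w).map f := rfl

lemma strength_naturality (R : Mon (Ctx T ⥤ Ctx T)) (w : Word T) {X Y : Ctx T} (f : X ⟶ Y) :
    (ext w).map (R.X.map f) ≫ strength R w Y =
      strength R w X ≫ R.X.map ((ext w).map f) := by
  refine ext_hom_ext ?_ (fun t b => ?_)
  · rw [← reassoc_of% inlHom_naturality, inlHom_strength, reassoc_of% inlHom_strength,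
      ← R.X.map_comp, ← R.X.map_comp, inlHom_naturality]
  · exact ctx_congr (unitAt_naturality R ((ext w).map f)) t (Sum.inr b)

lemma strength_hom {R R' : Mon (Ctx T ⥤ Ctx T)} (a : R ⟶ R') (w : Word T) (X : Ctx T) :
    strength R w X ≫ a.hom.app ((ext w).obj X) =
      (ext w).map (a.hom.app X) ≫ strength R' w X := by
  refine ext_hom_ext ?_ (fun t b => ?_)
  · rw [← reassoc_of% inlHom_naturality, inlHom_strength, reassoc_of% inlHom_strength,
      a.hom.naturality]
  · exact ctx_congr (unitAt_hom a ((ext w).obj X)) t (Sum.inr b)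

lemma strength_one (R : Mon (Ctx T ⥤ Ctx T)) (w : Word T) (X : Ctx T) :
    (ext w).map (unitAt R X) ≫ strength R w X = unitAt R ((ext w).obj X) := by
  refine ext_hom_ext ?_ (fun t b => rfl)
  rw [← reassoc_of% inlHom_naturality, inlHom_strength, unitAt_naturality]

lemma strength_mul (R : Mon (Ctx T ⥤ Ctx T)) (w : Word T) (X : Ctx T) :
    (ext w).map (multAt R X) ≫ strength R w X =
      strength R w (R.X.obj X) ≫ R.X.map (strength R w X) ≫ multAt R ((ext w).obj X) := by
  refine ext_hom_ext ?_ (fun t b => ?_)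
  · rw [← reassoc_of% inlHom_naturality, inlHom_strength, reassoc_of% inlHom_strength,
      ← R.X.map_comp_assoc, inlHom_strength, multAt_naturality]
  · have h := unitAt_naturality R (strength R w X)
    have h' : strength R w X ≫ 𝟙 _ = unitAt R ((ext w).obj (R.X.obj X)) ≫
        R.X.map (strength R w X) ≫ multAt R ((ext w).obj X) := by
      rw [← reassoc_of% h, unitAt_multAt]
    exact ctx_congr h' t (Sum.inr b)

/-- The action of a monad on the functor associated with a signature: substitution under binders. -/
def sigAct (S : STSig.{u}) (R : Mon (Ctx S.ty ⥤ Ctx S.ty)) :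
    R.X ⊗ (sigFunctor S).obj R.X ⟶ (sigFunctor S).obj R.X where
  app X := opsMap S (fun w => R.X.map (strength R w X) ≫ multAt R ((ext w).obj X))
  naturality X Y f := opsMap_sq S (fun w => by
    have h : R.X.map ((ext w).map (R.X.map f)) ≫ R.X.map (strength R w Y) ≫
          multAt R ((ext w).obj Y) =
        (R.X.map (strength R w X) ≫ multAt R ((ext w).obj X)) ≫ R.X.map ((ext w).map f) := by
      rw [← R.X.map_comp_assoc, strength_naturality, R.X.map_comp_assoc, multAt_naturality,
        Category.assoc]
    exact h)

/-- The module signature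
`R ↦ ⊔ᵢ (R^(u₁)_{t₁} × … × R^(uₙ)_{tₙ}) · y_τ` on endofunctors associated with a simply-typed
signature. -/
def sig (S : STSig.{u}) : ModuleSignature (Ctx S.ty ⥤ Ctx S.ty) where
  toFunctor := Mon.forget _ ⋙ sigFunctor S
  mod R :=
   { smul := sigAct S R
     one_smul := NatTrans.ext (funext fun X =>
       (opsMap_comp S _ _ (fun w => by
          have h : R.X.map ((ext w).map (unitAt R X)) ≫ R.X.map (strength R w X) ≫
              multAt R ((ext w).obj X) = 𝟙 _ := by
            rw [← R.X.map_comp_assoc, strength_one, map_unitAt_multAt]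
          exact h)).trans (opsMap_id S (fun w => rfl)))
     mul_smul := NatTrans.ext (funext fun X =>
       (opsMap_sq S (fun w => by
          have h : R.X.map ((ext w).map (multAt R X)) ≫ R.X.map (strength R w X) ≫
              multAt R ((ext w).obj X) =
              (R.X.map (strength R w (R.X.obj X)) ≫ multAt R ((ext w).obj (R.X.obj X))) ≫
                R.X.map (strength R w X) ≫ multAt R ((ext w).obj X) := by
            rw [← R.X.map_comp_assoc, strength_mul, R.X.map_comp_assoc, R.X.map_comp_assoc,
              map_multAt_multAt, reassoc_of% multAt_naturality, Category.assoc]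
          exact h)).trans (Category.id_comp _).symm) }
  act_naturality {R R'} f := NatTrans.ext (funext fun X =>
    (opsMap_sq S (c := fun w => f.hom.app ((ext w).obj (R.X.obj X)))
      (d := fun w => R'.X.map ((ext w).map (f.hom.app X)) ≫
        R'.X.map (strength R' w X) ≫ multAt R' ((ext w).obj X)) (fun w => by
          have h : (R.X.map (strength R w X) ≫ multAt R ((ext w).obj X)) ≫
                f.hom.app ((ext w).obj X) =
              f.hom.app ((ext w).obj (R.X.obj X)) ≫ R'.X.map ((ext w).map (f.hom.app X)) ≫
              R'.X.map (strength R' w X) ≫ multAt R' ((ext w).obj X) := by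
            rw [← R'.X.map_comp_assoc, ← strength_hom, R'.X.map_comp_assoc, Category.assoc,
              multAt_hom, f.hom.naturality_assoc]
          exact h)).trans
    ((congrArg (_ ≫ ·) (opsMap_comp S (fun w => R'.X.map ((ext w).map (f.hom.app X)))
      (fun w => R'.X.map (strength R' w X) ≫ multAt R' ((ext w).obj X))
      (fun _ => rfl)).symm).trans (Category.assoc _ _ _).symm))

end

/-- A simply-typed signature over `T` as a module signature on the endofunctors of families indexed
by `T`. -/
def STSig.toModSig (S : STSig.{u}) : ModSig.{u + 1, u + 1} where
  carrier := Ctx S.ty ⥤ Ctx S.ty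
  monoidal := endofunctorMonoidalCategory _
  sig := sig S


section Retyping

variable {S S' S'' : STSig.{u}}

/-- The canonical map `Lan_g (X + y_u) ⟶ Lan_g X + y_{g u}`. -/
def lanExt (g : T → T') (w : Word T) (X : Ctx T) :
    (lan g).obj ((ext w).obj X) ⟶ (ext (w.map g)).obj ((lan g).obj X) := fun _ =>
  ↾(fun x => match x with
    | ⟨t, Sum.inl y, e⟩ => Sum.inl ⟨t, y, e⟩
    | ⟨_, Sum.inr b, e⟩ => Sum.inr ⟨b.1, ⟨⟨e.down.down.trans (congrArg g b.2.down.down)⟩⟩⟩)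

lemma lanExt_naturality (g : T → T') (w : Word T) {X Y : Ctx T} (f : X ⟶ Y) :
    (lan g).map ((ext w).map f) ≫ lanExt g w Y =
      lanExt g w X ≫ (ext (w.map g)).map ((lan g).map f) :=
  ctx_ext fun _ x => match x with
    | ⟨_, Sum.inl _, _⟩ => rfl
    | ⟨_, Sum.inr _, _⟩ => rfl

lemma lan_inlHom_lanExt (g : T → T') (w : Word T) (X : Ctx T) :
    (lan g).map (inlHom w X) ≫ lanExt g w X = inlHom (w.map g) ((lan g).obj X) := rfl

/-- The map from the value of an arity to that of the retyped arity. -/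
def retypeVal (g : T → T') (P : Word T' → Ctx T') (α : BindingArity T) (t : T)
    (x : α.val (fun w => (res g).obj (P (w.map g))) t) : (α.retype g).val P (g t) :=
  (x.1, ⟨⟨congrArg g x.2.down.down⟩⟩)

/-- The operations of `S` as operations of `S'`, through a morphism `S ⟶ S'`. -/
def retypeOps (f : S ⟶ S') (P : Word S'.ty → Ctx S'.ty) :
    opsObj S (fun w => (res f.onTy).obj (P (w.map f.onTy))) ⟶
      (res f.onTy).obj (opsObj S' P) := fun t =>
  ↾(fun x => ⟨f.onLabel x.1, cast (congrArg (fun α => BindingArity.val P α (f.onTy t))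
    (f.arity_eq x.1).symm) (retypeVal f.onTy P (S.arity x.1) t x.2)⟩)

lemma retypeOps_naturality (f : S ⟶ S') {P Q : Word S'.ty → Ctx S'.ty} (φ : ∀ w, P w ⟶ Q w) :
    opsMap S (fun w => (res f.onTy).map (φ (w.map f.onTy))) ≫ retypeOps f Q =
      retypeOps f P ≫ (res f.onTy).map (opsMap S' φ) :=
  ctx_ext fun t x => by
    have h : ∀ {α β : BindingArity S'.ty} (e : α = β) (s : S'.ty) (y : α.val P s),
      cast (congrArg (fun α => BindingArity.val Q α s) e)
        ((fun k => φ _ _ (y.1 k), y.2) : α.val Q s) =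
      (fun k => φ _ _ ((cast (congrArg (fun α => BindingArity.val P α s) e) y).1 k),
        (cast (congrArg (fun α => BindingArity.val P α s) e) y).2) := by
      rintro α _ rfl s y
      rfl
    exact congrArg (Sigma.mk (f.onLabel x.1)) (h (f.arity_eq x.1).symm (f.onTy t)
      (retypeVal f.onTy P (S.arity x.1) t x.2))

/-- The comparison map `Σ_S (g^* ∘ F ∘ Lan_g) ⟶ g^* ∘ Σ_{S'} F ∘ Lan_g`. -/
def retypeApp (f : S ⟶ S') (F : Ctx S'.ty ⥤ Ctx S'.ty) :
    sigObj S ((conj (lan f.onTy) (res f.onTy)).obj F) ⟶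
      (conj (lan f.onTy) (res f.onTy)).obj (sigObj S' F) where
  app X := opsMap S (fun w => (res f.onTy).map (F.map (lanExt f.onTy w X))) ≫
    retypeOps f (fun w => F.obj ((ext w).obj ((lan f.onTy).obj X)))
  naturality X Y a := by
    have h₁ := retypeOps_naturality f (fun w => F.map ((ext w).map ((lan f.onTy).map a)))
    have h₂ := opsMap_sq S
      (a := fun w => (res f.onTy).map (F.map ((lan f.onTy).map ((ext w).map a))))
      (b := fun w => (res f.onTy).map (F.map (lanExt f.onTy w Y)))
      (c := fun w => (res f.onTy).map (F.map (lanExt f.onTy w X)))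
      (d := fun w => (res f.onTy).map (F.map ((ext (w.map f.onTy)).map ((lan f.onTy).map a))))
      (fun w => map_map_sq F _ (lanExt_naturality f.onTy w a))
    refine Eq.trans ?_ ((congrArg (_ ≫ ·) h₁).trans (Category.assoc _ _ _).symm)
    exact (Category.assoc _ _ _).symm.trans ((congrArg (· ≫ _) h₂).trans (Category.assoc _ _ _))

attribute [local instance] endofunctorMonoidalCategory
attribute [local instance] endoStruct

lemma lan_strength (g : T → T') (R : Mon (Ctx T' ⥤ Ctx T')) (w : Word T) (X : Ctx T) :
    letI := conjLax (lanAdj g)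
    (lan g).map (strength ((conj (lan g) (res g)).mapMon.obj R) w X) ≫
      (lanAdj g).counit.app (R.X.obj ((lan g).obj ((ext w).obj X))) ≫ R.X.map (lanExt g w X) =
    lanExt g w ((res g).obj (R.X.obj ((lan g).obj X))) ≫
      (ext (w.map g)).map ((lanAdj g).counit.app (R.X.obj ((lan g).obj X))) ≫
        strength R (w.map g) ((lan g).obj X) :=
  ctx_ext fun t' x => by
    obtain ⟨t, x | b, ⟨⟨e⟩⟩⟩ := x
    · subst e
      have h : R.X.map ((lan g).map (inlHom w X)) ≫ R.X.map (lanExt g w X) =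
        R.X.map (inlHom (w.map g) ((lan g).obj X)) := by
        rw [← R.X.map_comp, lan_inlHom_lanExt]
      exact ctx_congr h (g t) x
    · subst e
      exact (ctx_congr (unitAt_naturality R (lanExt g w X)) (g t) ⟨t, Sum.inr b, ⟨⟨rfl⟩⟩⟩).symm

lemma map_multAt_aux {C : Type*} [Category* C] (R : Mon (C ⥤ C)) {A A' B B' D E : C}
    {a : A ⟶ B} {b : B ⟶ R.X.obj E} {k : E ⟶ D} {l : A ⟶ A'} {m : A' ⟶ B'} {n : B' ⟶ R.X.obj D}
    (h : a ≫ b ≫ R.X.map k = l ≫ m ≫ n) :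
    R.X.map a ≫ (R.X.map b ≫ multAt R E) ≫ R.X.map k =
      R.X.map l ≫ R.X.map m ≫ R.X.map n ≫ multAt R D := by
  have h' := congrArg (fun x => R.X.map x ≫ multAt R D) h
  simp only [Functor.map_comp, Category.assoc, multAt_naturality] at h' ⊢
  exact h'

lemma map_aux₃ {C D : Type*} [Category* C] [Category* D] (G : C ⥤ D) {A A' B E H K : C}
    {a : A ⟶ B} {b : B ⟶ E} {c : E ⟶ H} {d : H ⟶ K} {e : A ⟶ A'} {k : A' ⟶ K}
    (h : a ≫ (b ≫ c) ≫ d = e ≫ k) :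
    (G.map a ≫ G.map b ≫ G.map c) ≫ G.map d = G.map e ≫ G.map k := by
  simp only [← G.map_comp, Category.assoc, ← h]

/-- The morphism of module signatures induced by a morphism `S ⟶ S'` of simply-typed signatures. Its
lax monoidal functor is `F ↦ g^* ∘ F ∘ Lan_g`. -/
def retypeHom (f : S ⟶ S') : ModSig.Hom S'.toModSig S.toModSig where
  functor := conj (lan f.onTy) (res f.onTy)
  lax := conjLax (lanAdj f.onTy)
  app R := retypeApp f R.X
  naturality {R R'} a := NatTrans.ext (funext fun X => by
    have h₁ := retypeOps_naturality f
      (fun w => a.hom.app ((ext w).obj ((lan f.onTy).obj X)))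
    have h₂ := opsMap_sq S
      (a := fun w => (res f.onTy).map (a.hom.app ((lan f.onTy).obj ((ext w).obj X))))
      (b := fun w => (res f.onTy).map (R'.X.map (lanExt f.onTy w X)))
      (c := fun w => (res f.onTy).map (R.X.map (lanExt f.onTy w X)))
      (d := fun w => (res f.onTy).map (a.hom.app ((ext (w.map f.onTy)).obj ((lan f.onTy).obj X))))
      (fun w => map_sq _ (a.hom.naturality (lanExt f.onTy w X)).symm)
    refine Eq.trans ?_ ((congrArg (_ ≫ ·) h₁).trans (Category.assoc _ _ _).symm)
    exact (Category.assoc _ _ _).symm.trans ((congrArg (· ≫ _) h₂).trans (Category.assoc _ _ _)))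
  linear R := NatTrans.ext (funext fun X => by
    let L := lan f.onTy
    let ψ : ∀ v : Word S'.ty, R.X.obj ((ext v).obj (L.obj ((res f.onTy).obj
        (R.X.obj (L.obj X))))) ⟶ R.X.obj ((ext v).obj (L.obj X)) := fun v =>
      R.X.map ((ext v).map ((lanAdj f.onTy).counit.app (R.X.obj (L.obj X)))) ≫
        R.X.map (strength R v (L.obj X)) ≫ multAt R ((ext v).obj (L.obj X))
    have h₁ := retypeOps_naturality f ψ
    have h₂ := (((res f.onTy).map_comp _ _).symm.trans (congrArg (res f.onTy).map
      (opsMap_comp S' (fun v =>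
          R.X.map ((ext v).map ((lanAdj f.onTy).counit.app (R.X.obj (L.obj X)))))
        (fun v => R.X.map (strength R v (L.obj X)) ≫ multAt R ((ext v).obj (L.obj X)))
        (χ := ψ) (fun _ => rfl))))
    letI := conjLax (lanAdj f.onTy)
    have h₄ (w : Word S.ty) : R.X.map (L.map
          (strength ((conj (lan f.onTy) (res f.onTy)).mapMon.obj R) w X)) ≫
        (R.X.map ((lanAdj f.onTy).counit.app (R.X.obj (L.obj ((ext w).obj X)))) ≫
          multAt R (L.obj ((ext w).obj X))) ≫ R.X.map (lanExt f.onTy w X) =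
        R.X.map (lanExt f.onTy w ((res f.onTy).obj (R.X.obj (L.obj X)))) ≫
          ψ (w.map f.onTy) := by
      exact map_multAt_aux R (lan_strength f.onTy R w X)
    have h₃ := opsMap_sq S
      (a := fun w => (res f.onTy).map (R.X.map (L.map
          (strength ((conj (lan f.onTy) (res f.onTy)).mapMon.obj R) w X))) ≫
        (res f.onTy).map (R.X.map ((lanAdj f.onTy).counit.app
            (R.X.obj (L.obj ((ext w).obj X))))) ≫
          (res f.onTy).map (multAt R (L.obj ((ext w).obj X))))
      (b := fun w => (res f.onTy).map (R.X.map (lanExt f.onTy w X)))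
      (c := fun w => (res f.onTy).map (R.X.map
        (lanExt f.onTy w ((res f.onTy).obj (R.X.obj (L.obj X))))))
      (d := fun w => (res f.onTy).map (ψ (w.map f.onTy)))
      (fun w => map_aux₃ (res f.onTy) (h₄ w))
    have h₅ := (Category.assoc _ _ _).trans ((congrArg (_ ≫ ·)
      ((congrArg (_ ≫ ·) h₂).trans h₁.symm)).trans ((Category.assoc _ _ _).symm.trans
        ((congrArg (· ≫ _) h₃.symm).trans (Category.assoc _ _ _))))
    exact h₅.symm)

/-- `Lan_id` is isomorphic to the identity. -/
def lanId (T : Type u) : lan (id : T → T) ≅ 𝟭 _ where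
  hom := (lanAdj id).counit
  inv := (lanAdj id).unit
  hom_inv_id := NatTrans.ext (funext fun X => ctx_ext fun t' x => by
    obtain ⟨t, x, ⟨⟨e⟩⟩⟩ := x
    obtain rfl : t' = t := e
    rfl)
  inv_hom_id := NatTrans.ext (funext fun X => ctx_ext fun t' x => rfl)

/-- `Lan_{h ∘ g}` is isomorphic to `Lan_h ∘ Lan_g`. -/
def lanComp {T'' : Type u} (g : T → T') (h : T' → T'') : lan (h ∘ g) ≅ lan g ⋙ lan h where
  hom :=
    { app X := fun _ => ↾(fun x => ⟨g x.1, ⟨x.1, x.2.1, ⟨⟨rfl⟩⟩⟩, x.2.2⟩)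
      naturality _ _ _ := rfl }
  inv :=
    { app X := fun _ => ↾(fun x => ⟨x.2.1.1, x.2.1.2.1,
        ⟨⟨x.2.2.down.down.trans (congrArg h x.2.1.2.2.down.down)⟩⟩⟩)
      naturality _ _ _ := rfl }
  hom_inv_id := rfl
  inv_hom_id := NatTrans.ext (funext fun X => ctx_ext fun t' x => by
    obtain ⟨t, ⟨t', x, ⟨⟨e⟩⟩⟩, e'⟩ := x
    subst e
    rfl)

def conjId (T : Type u) : conj (lan (id : T → T)) (res id) ≅ 𝟭 _ :=
  NatIso.ofComponents (fun F => NatIso.ofComponents (fun X => F.mapIso ((lanId T).app X))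
    (fun f => map_sq F ((lanId T).hom.naturality f)))
    (fun a => NatTrans.ext (funext fun X => (a.naturality _).symm))

def conjComp {T'' : Type u} (g : T → T') (h : T' → T'') :
    conj (lan (h ∘ g)) (res (h ∘ g)) ≅ conj (lan h) (res h) ⋙ conj (lan g) (res g) :=
  NatIso.ofComponents (fun F => NatIso.ofComponents
    (fun X => (res (h ∘ g)).mapIso (F.mapIso ((lanComp g h).app X)))
    (fun f => map_map_sq F (res (h ∘ g)) ((lanComp g h).hom.naturality f)))
    (fun a => NatTrans.ext (funext fun X => (map_sq (res (h ∘ g)) (a.naturality _)).symm))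

lemma conjId_isMonoidal (T : Type u) :
    letI := conjLax (lanAdj (id : T → T))
    NatTrans.IsMonoidal (conjId T).hom :=
  letI := conjLax (lanAdj (id : T → T))
  { unit := NatTrans.ext (funext fun X => ctx_ext fun t' x => rfl)
    tensor F G := NatTrans.ext (funext fun X => (Category.comp_id _).symm) }

lemma lanComp_counit {T'' : Type u} (g : T → T') (h : T' → T'') {Y Z : Ctx T''} (k : Y ⟶ Z) :
    (lanAdj (h ∘ g)).counit.app Y ≫ k = (lanComp g h).hom.app ((res (h ∘ g)).obj Y) ≫
      (lan h).map ((lan g).map ((res (h ∘ g)).map k)) ≫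
      (lan h).map ((lanAdj g).counit.app ((res h).obj Z)) ≫ (lanAdj h).counit.app Z :=
  ctx_ext fun t' x => by
    obtain ⟨t, x, ⟨⟨e⟩⟩⟩ := x
    obtain rfl : t' = h (g t) := e
    rfl

lemma map_map_aux₄ {C D E : Type*} [Category* C] [Category* D] [Category* E] (G : C ⥤ D)
    (R : D ⥤ E) {X Y Z A B C' : C} {a : X ⟶ Y} {b : Y ⟶ Z} {c : X ⟶ A} {d : A ⟶ B} {e : B ⟶ C'}
    {f : C' ⟶ Z} (h : a ≫ b = c ≫ d ≫ e ≫ f) :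
    R.map (G.map a) ≫ R.map (G.map b) = (R.map (G.map c) ≫ R.map (G.map d)) ≫
      R.map (G.map e) ≫ R.map (G.map f) := by
  simp only [← R.map_comp, ← G.map_comp, h, Category.assoc]


lemma conjComp_isMonoidal {T'' : Type u} (g : T → T') (h : T' → T'') :
    letI := conjLax (lanAdj g)
    letI := conjLax (lanAdj h)
    letI := conjLax (lanAdj (h ∘ g))
    NatTrans.IsMonoidal (conjComp g h).hom :=
  letI := conjLax (lanAdj g)
  letI := conjLax (lanAdj h)
  letI := conjLax (lanAdj (h ∘ g))
  { unit := NatTrans.ext (funext fun X => ctx_ext fun t' x => rfl)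
    tensor F G := NatTrans.ext (funext fun X =>
      map_map_aux₄ G (res (h ∘ g)) (lanComp_counit g h (F.map ((lanComp g h).hom.app X)))) }

lemma retypeOps_id (P : Word S.ty → Ctx S.ty) : retypeOps (𝟙 S) P = 𝟙 (opsObj S P) :=
  ctx_ext fun _ _ => rfl

lemma lanExt_id (w : Word T) (X : Ctx T) :
    lanExt (id : T → T) w X ≫ (ext w).map ((lanId T).hom.app X) =
      (lanId T).hom.app ((ext w).obj X) :=
  ctx_ext fun t x => match x with
    | ⟨t', Sum.inl x, ⟨⟨e⟩⟩⟩ => by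
      obtain rfl : t = t' := e
      rfl
    | ⟨t', Sum.inr x, ⟨⟨e⟩⟩⟩ => by
      obtain rfl : t = t' := e
      rfl

lemma retypeOps_comp (f : S ⟶ S') (g : S' ⟶ S'') (P : Word S''.ty → Ctx S''.ty) :
    retypeOps (f ≫ g) P = retypeOps f (fun w => (res g.onTy).obj (P (w.map g.onTy))) ≫
      (res f.onTy).map (retypeOps g P) :=
  ctx_ext fun t x => by
    have h : ∀ {α : BindingArity S.ty} {β : BindingArity S'.ty} {γ : BindingArity S''.ty}
        (e₁ : α.retype f.onTy = β) (e₂ : β.retype g.onTy = γ)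
        (e₃ : α.retype (g.onTy ∘ f.onTy) = γ)
        (y : α.val (fun w => (res (g.onTy ∘ f.onTy)).obj (P (w.map (g.onTy ∘ f.onTy)))) t),
        cast (congrArg (fun α => BindingArity.val P α (g.onTy (f.onTy t))) e₃)
          (retypeVal (g.onTy ∘ f.onTy) P α t y) =
        cast (congrArg (fun α => BindingArity.val P α (g.onTy (f.onTy t))) e₂)
          (retypeVal g.onTy P β (f.onTy t)
            (cast (congrArg (fun β => BindingArity.val
                (fun w => (res g.onTy).obj (P (w.map g.onTy))) β (f.onTy t)) e₁)
              (retypeVal f.onTy (fun w => (res g.onTy).obj (P (w.map g.onTy))) α t y))) := by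
      rintro α _ _ rfl rfl e₃ y
      rfl
    exact congrArg (Sigma.mk (g.onLabel (f.onLabel x.1)))
      (h (f.arity_eq x.1).symm (g.arity_eq (f.onLabel x.1)).symm ((f ≫ g).arity_eq x.1).symm x.2)

lemma lanExt_comp {T'' : Type u} (g : T → T') (h : T' → T'') (w : Word T) (X : Ctx T) :
    lanExt (h ∘ g) w X ≫ (ext (w.map (h ∘ g))).map ((lanComp g h).hom.app X) =
      (lanComp g h).hom.app ((ext w).obj X) ≫ (lan h).map (lanExt g w X) ≫
        lanExt h (w.map g) ((lan g).obj X) :=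
  ctx_ext fun t x => match x with
    | ⟨_, Sum.inl _, _⟩ => rfl
    | ⟨_, Sum.inr _, _⟩ => rfl

/-- The identity of `S` induces a morphism isomorphic to the identity. -/
def retypeId (S : STSig.{u}) : retypeHom (𝟙 S) ≅ ModSig.Hom.id S.toModSig :=
  ModSig.isoMk (conjId S.ty) (conjId_isMonoidal S.ty) (fun R => NatTrans.ext (funext fun X => by
    have h₁ := (congrArg (_ ≫ ·) (retypeOps_id (S := S) (fun w =>
      R.X.obj ((ext w).obj ((lan id).obj X))))).trans (Category.comp_id (opsMap S (fun w =>
        R.X.map (lanExt (id : S.ty → S.ty) w X))))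
    have h₂ := opsMap_comp S (fun w => R.X.map (lanExt (id : S.ty → S.ty) w X))
      (fun w => R.X.map ((ext w).map ((lanId S.ty).hom.app X)))
      (χ := fun w => R.X.map ((lanId S.ty).hom.app ((ext w).obj X)))
      (fun w => (R.X.map_comp _ _).symm.trans (congrArg R.X.map (lanExt_id w X)))
    exact ((congrArg (· ≫ _) h₁).trans h₂).trans (Category.comp_id _).symm))

lemma map_map_aux₃ {C D E : Type*} [Category* C] [Category* D] [Category* E] (G : C ⥤ D)
    (R : D ⥤ E) {X Y Z A B : C} {a : X ⟶ Y} {b : Y ⟶ Z} {c : X ⟶ A} {d : A ⟶ B} {e : B ⟶ Z}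
    (h : a ≫ b = c ≫ d ≫ e) :
    R.map (G.map a) ≫ R.map (G.map b) =
      R.map (G.map c) ≫ R.map (G.map d) ≫ R.map (G.map e) := by
  simp only [← R.map_comp, ← G.map_comp, h]

lemma retypeComp_aux {C D : Type*} [Category* C] [Category* D] (G : D ⥤ C)
    {p₀ p₁ p₂ p₄ p₅ p₆ : C} {m l n : D} {k : p₀ ⟶ p₁} {a₁ : p₁ ⟶ p₂} {r : p₂ ⟶ G.obj n}
    {r' : p₁ ⟶ p₄} {a₂ : p₄ ⟶ G.obj n} (h₁ : a₁ ≫ r = r' ≫ a₂)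
    {s : p₂ ⟶ G.obj m} {t : m ⟶ n} (h₂ : r = s ≫ G.map t)
    {d₂ : p₆ ⟶ p₂} {s' : p₆ ⟶ G.obj l} {e : l ⟶ m} (h₃ : d₂ ≫ s = s' ≫ G.map e)
    {c : p₀ ⟶ p₅} {d : p₅ ⟶ p₂} (h₄ : k ≫ a₁ = c ≫ d)
    {d₁ : p₅ ⟶ p₆} (h₅ : d₁ ≫ d₂ = d) :
    (k ≫ r') ≫ a₂ = c ≫ 𝟙 _ ≫ (d₁ ≫ s') ≫ G.map (e ≫ t) := by
  subst h₂ h₅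
  rw [Category.assoc, ← h₁, reassoc_of% h₄, reassoc_of% h₃]
  simp

/-- Compatibility of the induced morphisms with composition. -/
def retypeComp (f : S ⟶ S') (g : S' ⟶ S'') :
    retypeHom (f ≫ g) ≅ (retypeHom g).comp (retypeHom f) :=
  ModSig.isoMk (conjComp f.onTy g.onTy) (conjComp_isMonoidal f.onTy g.onTy)
    (fun R => NatTrans.ext (funext fun X => by
      let c := (lanComp f.onTy g.onTy).hom.app X
      have h₁ := retypeOps_naturality (f ≫ g) (fun w => R.X.map ((ext w).map c))
      have h₂ := retypeOps_comp f g
        (fun w => R.X.obj ((ext w).obj ((lan g.onTy).obj ((lan f.onTy).obj X))))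
      have h₃ := retypeOps_naturality f (fun w => (res g.onTy).map
        (R.X.map (lanExt g.onTy w ((lan f.onTy).obj X))))
      have h₄ := opsMap_sq S
        (a := fun w => (res (f ≫ g).onTy).map (R.X.map (lanExt (f ≫ g).onTy w X)))
        (b := fun w => (res (f ≫ g).onTy).map (R.X.map ((ext (w.map (f ≫ g).onTy)).map c)))
        (c := fun w => (res (f ≫ g).onTy).map
          (R.X.map ((lanComp f.onTy g.onTy).hom.app ((ext w).obj X))))
        (d := fun w => (res (f ≫ g).onTy).map (R.X.map ((lan g.onTy).map (lanExt f.onTy w X))) ≫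
          (res (f ≫ g).onTy).map (R.X.map (lanExt g.onTy (w.map f.onTy) ((lan f.onTy).obj X))))
        (fun w => map_map_aux₃ R.X (res (f ≫ g).onTy) (lanExt_comp f.onTy g.onTy w X))
      have h₅ := opsMap_comp S
        (fun w => (res (f ≫ g).onTy).map (R.X.map ((lan g.onTy).map (lanExt f.onTy w X))))
        (fun w => (res (f ≫ g).onTy).map
          (R.X.map (lanExt g.onTy (w.map f.onTy) ((lan f.onTy).obj X))))
        (fun _ => rfl)
      exact retypeComp_aux (res f.onTy)
        (n := (res g.onTy).obj (opsObj S'' (fun w =>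
          R.X.obj ((ext w).obj ((lan g.onTy).obj ((lan f.onTy).obj X))))))
        h₁ h₂ h₃ h₄ h₅))


lemma lanComp_assoc {T'' T''' : Type u} (g : T → T') (h : T' → T'') (k : T'' → T''') (X : Ctx T) :
    (lanComp g (k ∘ h)).hom.app X ≫ (lanComp h k).hom.app ((lan g).obj X) ≫
      (lan k).map ((lanComp g h).inv.app X) ≫ (lanComp (h ∘ g) k).inv.app X = 𝟙 _ :=
  ctx_ext fun _ _ => rfl

lemma lanComp_lanId (g : T → T') (X : Ctx T) :
    (lanComp g id).hom.app X ≫ (lanId T').hom.app ((lan g).obj X) = 𝟙 _ :=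
  ctx_ext fun t x => by
    obtain ⟨t', x, ⟨⟨e⟩⟩⟩ := x
    obtain rfl : t = g t' := e
    rfl

lemma lanId_lanComp (g : T → T') (X : Ctx T) :
    (lanComp id g).hom.app X ≫ (lan g).map ((lanId T).hom.app X) = 𝟙 _ :=
  ctx_ext fun t x => by
    obtain ⟨t', x, ⟨⟨e⟩⟩⟩ := x
    obtain rfl : t = g t' := e
    rfl

lemma map_map_id₄ {C D E : Type*} [Category* C] [Category* D] [Category* E] (G : C ⥤ D)
    (R : D ⥤ E) {X Y Z A : C} {a : X ⟶ Y} {b : Y ⟶ Z} {c : Z ⟶ A} {d : A ⟶ X}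
    (h : a ≫ b ≫ c ≫ d = 𝟙 X) :
    R.map (G.map a) ≫ R.map (G.map b) ≫ 𝟙 _ ≫ R.map (G.map c) ≫ R.map (G.map d) = 𝟙 _ := by
  rw [Category.id_comp]
  simp only [← R.map_comp, ← G.map_comp, h]
  rw [G.map_id, R.map_id]

lemma map_map_id₂ {C D E : Type*} [Category* C] [Category* D] [Category* E] (G : C ⥤ D)
    (R : D ⥤ E) {X Y : C} {a : X ⟶ Y} {b : Y ⟶ X} (h : a ≫ b = 𝟙 X) :
    R.map (G.map a) ≫ R.map (G.map b) ≫ 𝟙 _ = 𝟙 _ := by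
  rw [Category.comp_id, ← R.map_comp, ← G.map_comp, h, G.map_id, R.map_id]

end Retyping

open Opposite

/-- The functor from (the opposite of) simply-typed signatures to module signatures. As `Lan_g` is
functorial in `g` up to canonical isomorphism, so is this functor. -/
def stSigToModSig : Pseudofunctor (LocallyDiscrete STSig.{u}ᵒᵖ) ModSig.{u + 1, u + 1} :=
  LocallyDiscrete.mkPseudofunctor
    (fun S => S.unop.toModSig)
    (fun f => retypeHom f.unop)
    (fun S => retypeId S.unop)
    (fun f g => retypeComp g.unop f.unop)
    (fun {a b c d} (f : a ⟶ b) (g : b ⟶ c) (h : c ⟶ d) => ModSig.Hom₂.ext' (NatTrans.ext (funext fun F => NatTrans.ext (funext fun X =>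
      map_map_id₄ F (res (f.unop.onTy ∘ g.unop.onTy ∘ h.unop.onTy))
        (lanComp_assoc h.unop.onTy g.unop.onTy f.unop.onTy X)))))
    (fun {a b} (f : a ⟶ b) => ModSig.Hom₂.ext' (NatTrans.ext (funext fun F => NatTrans.ext (funext fun X =>
      map_map_id₂ F (res f.unop.onTy) (lanComp_lanId f.unop.onTy X)))))
    (fun {a b} (f : a ⟶ b) => ModSig.Hom₂.ext' (NatTrans.ext (funext fun F => NatTrans.ext (funext fun X =>
      map_map_id₂ F (res f.unop.onTy) (lanId_lanComp f.unop.onTy X)))))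

/-- The functor sending a simply-typed signature to its category of models. -/
def STSigModel : Pseudofunctor (LocallyDiscrete STSig.{u}ᵒᵖ) Cat.{u + 1, u + 1} :=
  stSigToModSig.comp models


end InitSem

/-! Two independent constructions carry the theorem: the syntax of a signature is an initial model,
and any pseudofunctor from a 1-category to `Cat` (of suitable size) is equivalent to a strict
functor. The second uses nothing about signatures.

Initiality. Free variables come from a family `X`, while the words bound on the way down a term are
kept in a list `Γ`. Only the list is an index of `Term`, so that `X` stays a parameter and terms
remain in `Type u`. The monad of terms is the case `Γ = []`. Since `extList ((ext w).obj X) []` and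
`extList X [w]` are definitionally the same family, `ren` along an identity passes between the two
encodings of a term under one binder. The fusion laws of renaming and substitution, ending with
`sub_sub`, give the monad laws. A model interprets variables by the unit of its monad and operations
by its action. That this respects substitution is `eval_sub`, where linearity of the action is used.
Conversely a morphism of models out of terms is forced on variables by the unit law and on
operations by compatibility with the actions, whence `termHomApp_eq_eval` by induction.

Strictification. An object over `b` is left unevaluated: a morphism `s ⟶ b` with an object of `G s`;
morphisms are those of the actual images. Pushing along `h` merely composes with `h`, which is
strictly associative and unital. On morphisms one conjugates by the comparison isomorphisms of `G`,
and its coherence laws yield `push_id` and `push_comp`. The same isomorphisms make evaluation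
pseudonatural. -/

namespace InitSem

/-! ### Terms with binding: renaming and substitution. -/

section Terms

/-- The family `X` extended successively by the words of a list. -/
def extList {T : Type u} (X : Ctx T) : List (Word T) → Ctx T
  | [] => X
  | w :: Γ => (ext w).obj (extList X Γ)

/-- Terms over a signature, with free variables in `X` and bound variables in the words `Γ`. -/
inductive Term (S : STSig.{u}) (X : Ctx S.ty) : List (Word S.ty) → S.ty → Type u
  | var {Γ : List (Word S.ty)} {t : S.ty} (x : extList X Γ t) : Term S X Γ t
  | op {Γ : List (Word S.ty)} {t : S.ty} (i : S.label)
      (args : ∀ k : Fin (S.arity i).args.length,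
        Term S X (((S.arity i).args.get k).1 :: Γ) ((S.arity i).args.get k).2)
      (e : yo (S.arity i).target t) : Term S X Γ t

namespace Term

variable {S : STSig.{u}} {X Y Z : Ctx S.ty} {Γ Δ Θ : List (Word S.ty)}

/-- The family of terms over `X` and `Γ`. -/
def fam (S : STSig.{u}) (X : Ctx S.ty) (Γ : List (Word S.ty)) : Ctx S.ty := fun t => Term S X Γ t

/-- Variables as terms. -/
def varHom (S : STSig.{u}) (X : Ctx S.ty) (Γ : List (Word S.ty)) : extList X Γ ⟶ fam S X Γ :=
  fun _ => ↾var

/-- The extension of a renaming under binders. -/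
def liftRen (w : Word S.ty) (f : extList X Γ ⟶ extList Y Δ) :
    extList X (w :: Γ) ⟶ extList Y (w :: Δ) := (ext w).map f

lemma liftRen_id (w : Word S.ty) : liftRen w (𝟙 (extList X Γ)) = 𝟙 (extList X (w :: Γ)) :=
  (ext w).map_id _

lemma liftRen_comp (w : Word S.ty) (f : extList X Γ ⟶ extList Y Δ)
    (g : extList Y Δ ⟶ extList Z Θ) : liftRen w (f ≫ g) = liftRen w f ≫ liftRen w g :=
  (ext w).map_comp _ _

/-- Renaming. -/
def ren {X Y : Ctx S.ty} : ∀ {Γ Δ : List (Word S.ty)} {t : S.ty},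
    (extList X Γ ⟶ extList Y Δ) → Term S X Γ t → Term S Y Δ t
  | _, _, t, f, var x => var (f t x)
  | _, Δ, _, f, op i a e => op i (fun k => ren (liftRen _ f) (a k)) e

/-- Renaming as a morphism of families. -/
def renHom (f : extList X Γ ⟶ extList Y Δ) : fam S X Γ ⟶ fam S Y Δ := fun _ => ↾(ren f)

lemma ren_id {t : S.ty} (x : Term S X Γ t) : ren (𝟙 (extList X Γ)) x = x := by
  induction x with
  | var x => rfl
  | op i a e ih =>
    refine congrArg (op i · e) (funext fun k => ?_)
    rw [liftRen_id]
    exact ih k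

/-- The lists `Δ` and `Θ` are quantified after the term because each binder replaces `f` and `g` by
their lifts. The families may differ too, so the law also covers identity renamings that move a word
between family and list. -/
lemma ren_ren {t : S.ty} (x : Term S X Γ t) : ∀ {Δ Θ : List (Word S.ty)}
    (f : extList X Γ ⟶ extList Y Δ) (g : extList Y Δ ⟶ extList Z Θ),
    ren g (ren f x) = ren (f ≫ g) x := by
  induction x with
  | var x => exact fun f g => rfl
  | op i a e ih =>
    intro Δ Θ f g
    refine congrArg (op i · e) (funext fun k => ?_)
    rw [liftRen_comp]
    exact ih k _ _

/-- The extension of a substitution under binders. -/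
def liftSub (w : Word S.ty) (σ : extList X Γ ⟶ fam S Y Δ) :
    extList X (w :: Γ) ⟶ fam S Y (w :: Δ) := fun t =>
  ↾(Sum.elim (fun x => ren (Δ := w :: Δ) (inlHom w (extList Y Δ)) (σ t x))
    (fun b => var (Sum.inr b)))

/-- Substitution. -/
def sub {X Y : Ctx S.ty} : ∀ {Γ Δ : List (Word S.ty)} {t : S.ty},
    (extList X Γ ⟶ fam S Y Δ) → Term S X Γ t → Term S Y Δ t
  | _, _, t, σ, var x => σ t x
  | _, _, _, σ, op i a e => op i (fun k => sub (liftSub _ σ) (a k)) e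

/-- Substitution as a morphism of families. -/
def subHom (σ : extList X Γ ⟶ fam S Y Δ) : fam S X Γ ⟶ fam S Y Δ := fun _ => ↾(sub σ)

/-- Separates the variables already in scope from the newly bound ones. The commutation of lifts
with renaming, substitution and evaluation is checked this way. -/
lemma liftSub_ext {w : Word S.ty} {f g : extList X (w :: Γ) ⟶ Y}
    (h₁ : ∀ t (x : extList X Γ t), f t (Sum.inl x) = g t (Sum.inl x))
    (h₂ : ∀ t (b : bound w t), f t (Sum.inr b) = g t (Sum.inr b)) : f = g :=
  ctx_ext fun t x => match x with
    | Sum.inl x => h₁ t x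
    | Sum.inr b => h₂ t b

/-- The induction passes under binders because the substitution of variables for themselves lifts to
one of the same kind. -/
lemma sub_var {t : S.ty} (x : Term S X Γ t) : sub (varHom S X Γ) x = x := by
  induction x with
  | var x => rfl
  | @op Γ t i a e ih =>
    refine congrArg (op i · e) (funext fun k => ?_)
    have h (w : Word S.ty) : liftSub w (varHom S X Γ) = varHom S X (w :: Γ) :=
      liftSub_ext (fun t x => rfl) (fun t b => rfl)
    rw [h]
    exact ih k

/-- First of three fusion laws; no other law is needed, since lifting commutes with precomposition
by a renaming definitionally on each kind of variable. -/
lemma sub_ren {t : S.ty} (x : Term S X Γ t) : ∀ {Δ Θ : List (Word S.ty)}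
    (f : extList X Γ ⟶ extList Y Δ) (σ : extList Y Δ ⟶ fam S Z Θ),
    sub σ (ren f x) = sub (f ≫ σ) x := by
  induction x with
  | var x => exact fun f g => rfl
  | @op Γ t i a e ih =>
    intro Δ Θ f σ
    refine congrArg (op i · e) (funext fun k => ?_)
    have h (w : Word S.ty) : liftRen w f ≫ liftSub w σ = liftSub w (f ≫ σ) :=
      liftSub_ext (fun t x => rfl) (fun t b => rfl)
    exact (ih k _ _).trans (congrArg (sub · (a k)) (h _))

/-- On an old variable, weakening must commute with the renaming `f`; both orders fuse by `ren_ren`.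
-/
lemma ren_sub {t : S.ty} (x : Term S X Γ t) : ∀ {Δ Θ : List (Word S.ty)}
    (σ : extList X Γ ⟶ fam S Y Δ) (f : extList Y Δ ⟶ extList Z Θ),
    ren f (sub σ x) = sub (σ ≫ renHom f) x := by
  induction x with
  | var x => exact fun f g => rfl
  | @op Γ t i a e ih =>
    intro Δ Θ σ f
    refine congrArg (op i · e) (funext fun k => ?_)
    have h (w : Word S.ty) : liftSub w σ ≫ renHom (liftRen w f) =
        liftSub w (σ ≫ renHom f) :=
      liftSub_ext (fun t x => (ren_ren (Δ := w :: Δ) (Θ := w :: Θ) (σ t x) _ _).trans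
        (ren_ren (Δ := Θ) (Θ := w :: Θ) (σ t x) f (inlHom w (extList Z Θ))).symm)
        (fun t b => rfl)
    exact (ih k _ _).trans (congrArg (sub · (a k)) (h _))

/-- On an old variable, `σ t x` is weakened and then substituted along the lift of `τ`; `sub_ren`
and `ren_sub` identify this with substituting along `τ` and then weakening. -/
lemma sub_sub {t : S.ty} (x : Term S X Γ t) : ∀ {Δ Θ : List (Word S.ty)}
    (σ : extList X Γ ⟶ fam S Y Δ) (τ : extList Y Δ ⟶ fam S Z Θ),
    sub τ (sub σ x) = sub (σ ≫ subHom τ) x := by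
  induction x with
  | var x => exact fun f g => rfl
  | @op Γ t i a e ih =>
    intro Δ Θ σ τ
    refine congrArg (op i · e) (funext fun k => ?_)
    have h (w : Word S.ty) : liftSub w σ ≫ subHom (liftSub w τ) = liftSub w (σ ≫ subHom τ) :=
      liftSub_ext (fun t x => (sub_ren (Δ := w :: Δ) (σ t x) _ _).trans
        (ren_sub (Δ := Θ) (Θ := w :: Θ) (σ t x) τ (inlHom w (extList Z Θ))).symm)
        (fun t b => rfl)
    exact (ih k _ _).trans (congrArg (sub · (a k)) (h _))

end Term

/-! ### The monad and the model of terms. -/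

/-- The functor of terms with free variables in a family. -/
def termFunctor (S : STSig.{u}) : Ctx S.ty ⥤ Ctx S.ty where
  obj X := Term.fam S X []
  map {X Y} f := Term.renHom (X := X) (Y := Y) (Γ := []) (Δ := []) f
  map_id X := ctx_ext fun _ x => Term.ren_id (X := X) x
  map_comp {X Y Z} f g := ctx_ext fun _ x =>
    (Term.ren_ren (Y := Y) (Z := Z) (Δ := []) (Θ := []) x f g).symm

/-- The substitution of terms for the variables of a term. -/
def termMul (S : STSig.{u}) (X : Ctx S.ty) :
    Term.fam S (Term.fam S X []) [] ⟶ Term.fam S X [] :=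
  Term.subHom (X := Term.fam S X []) (Γ := []) (𝟙 (Term.fam S X []))

attribute [local instance] endofunctorMonoidalCategory
attribute [local instance] endoStruct

/-- The monad of terms. -/
def termMon (S : STSig.{u}) : Mon (Ctx S.ty ⥤ Ctx S.ty) where
  X := termFunctor S
  mon :=
    { one :=
        { app X := Term.varHom S X []
          naturality _ _ _ := rfl }
      mul :=
        { app X := termMul S X
          naturality X Y f := ctx_ext fun t x =>
            (Term.sub_ren (Y := Term.fam S Y []) (Δ := []) x
              (Term.renHom (Γ := []) (Δ := []) f) (𝟙 (Term.fam S Y []))).trans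
              (Term.ren_sub (Y := X) (Z := Y) (Δ := []) (Θ := []) x (𝟙 (Term.fam S X [])) f).symm }
      -- Because `F ⊗ G = F ⋙ G`, this is the law replacing each variable by itself; `mul_one`,
      -- substitution into a lone variable, is definitional.
      one_mul := NatTrans.ext (funext fun X => ctx_ext fun t x =>
        (Term.sub_ren (Y := Term.fam S X []) (Δ := []) x (Term.varHom S X [])
          (𝟙 (Term.fam S X []))).trans (Term.sub_var x))
      mul_one := NatTrans.ext (funext fun X => ctx_ext fun t x => rfl)
      -- Both sides are the substitution along `termMul S X`, which flattens the term placed at each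
      -- outer variable.
      mul_assoc := NatTrans.ext (funext fun X => ctx_ext fun t x =>
        (Term.sub_ren (Y := Term.fam S X []) (Δ := []) x (termMul S X)
          (𝟙 (Term.fam S X []))).trans
          (Term.sub_sub (Y := Term.fam S X []) (Z := X) (Δ := []) (Θ := []) x
            (𝟙 (Term.fam S (Term.fam S X []) [])) (𝟙 (Term.fam S X []))).symm) }

/-- The operations on terms. -/
def termOp (S : STSig.{u}) (X : Ctx S.ty) :
    opsObj S (fun w => Term.fam S ((ext w).obj X) []) ⟶ Term.fam S X [] := fun _ =>
  ↾(fun x => Term.op x.1 (fun k => Term.ren (Γ := []) (Δ := [_]) (𝟙 ((ext _).obj X)) (x.2.1 k))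
    x.2.2)

/-- The model of terms. -/
def termModel (S : STSig.{u}) : S.toModSig.Model where
  mon := termMon S
  act :=
    { app X := termOp S X
      naturality X Y f := ctx_ext fun t x =>
        congrArg (Term.op x.1 · x.2.2) (funext fun k =>
          (Term.ren_ren (Y := (ext _).obj Y) (Z := Y) (Δ := []) (Θ := [_]) (x.2.1 k)
              ((ext _).map f) (𝟙 _)).trans
            (Term.ren_ren (Y := X) (Z := Y) (Δ := [_]) (Θ := [_]) (x.2.1 k) (𝟙 _)
              ((ext _).map f)).symm) }
  linear := NatTrans.ext (funext fun X => ctx_ext fun t x =>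
    congrArg (Term.op x.1 · x.2.2) (funext fun k => by
      -- Once the bound word has moved from the family to the list, `strength` is the lift of the
      -- identity substitution.
      have h (w : Word S.ty) :
          (show extList ((ext w).obj (Term.fam S X [])) [] ⟶
            Term.fam S ((ext w).obj X) [] from strength (termMon S) w X) ≫
            Term.renHom (Γ := []) (Δ := [w]) (𝟙 ((ext w).obj X)) =
          Term.liftSub (X := Term.fam S X []) (Γ := []) w (𝟙 (Term.fam S X [])) :=
        Term.liftSub_ext (Γ := []) (fun t x =>
          (Term.ren_ren (Y := (ext w).obj X) (Z := X) (Δ := []) (Θ := [w]) x _ _)) (fun t b => rfl)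
      -- The common value of the two sides: one re-indexes the argument after substituting, the
      -- other before.
      refine Eq.trans (b := Term.sub (Γ := []) (Δ := [_])
        (Term.liftSub (X := Term.fam S X []) (Γ := []) _ (𝟙 (Term.fam S X []))) (x.2.1 k)) ?_ ?_
      · rw [← h]
        refine Eq.trans ?_ (Term.ren_sub (Δ := []) (Θ := [_]) (x.2.1 k) _ _)
        exact congrArg _ (Term.sub_ren (Y := Term.fam S ((ext _).obj X) []) (Δ := [])
          (Θ := []) (x.2.1 k) _ _)
      · exact (Term.sub_ren (Y := Term.fam S X []) (Δ := [_]) (Θ := [_]) (x.2.1 k)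
          (𝟙 _) (Term.liftSub (X := Term.fam S X []) (Γ := []) _ (𝟙 (Term.fam S X [])))).symm))

end Terms
-- Interpretation of terms in a model, and its uniqueness.
section Initiality

variable {S : STSig.{u}} (M : S.toModSig.Model)

attribute [local instance] endofunctorMonoidalCategory
attribute [local instance] endoStruct

/-- The monad underlying a model. -/
def modelMonad : Mon (Ctx S.ty ⥤ Ctx S.ty) := M.mon

/-- The operations of a model, as a natural transformation. -/
def modelAct : sigObj S (modelMonad M).X ⟶ (modelMonad M).X := M.act

/-- The operations of a model at a family. -/
def modelOp (X : Ctx S.ty) : opsObj S (fun w => (modelMonad M).X.obj ((ext w).obj X)) ⟶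
    (modelMonad M).X.obj X := (modelAct M).app X

lemma modelOp_naturality {X Y : Ctx S.ty} (f : X ⟶ Y) :
    opsMap S (fun w => (modelMonad M).X.map ((ext w).map f)) ≫ modelOp M Y =
      modelOp M X ≫ (modelMonad M).X.map f := (modelAct M).naturality f

lemma modelOp_linear (X : Ctx S.ty) :
    opsMap S (fun w => (modelMonad M).X.map (strength (modelMonad M) w X) ≫
        multAt (modelMonad M) ((ext w).obj X)) ≫ modelOp M X =
      modelOp M ((modelMonad M).X.obj X) ≫ multAt (modelMonad M) X :=
  congrArg (fun (a : (modelMonad M).X ⋙ sigObj S (modelMonad M).X ⟶ (modelMonad M).X) =>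
    NatTrans.app a X) M.linear

namespace Term

variable {X Y : Ctx S.ty} {Γ Δ : List (Word S.ty)}

/-- The interpretation of terms in a model. -/
def eval {X : Ctx S.ty} : ∀ {Γ : List (Word S.ty)} {t : S.ty},
    Term S X Γ t → (modelMonad M).X.obj (extList X Γ) t
  | Γ, t, var x => unitAt (modelMonad M) (extList X Γ) t x
  | Γ, t, op i a e => modelOp M (extList X Γ) t ⟨i, fun k => eval (a k), e⟩

/-- The interpretation of terms as a morphism of families. -/
def evalHom (X : Ctx S.ty) (Γ : List (Word S.ty)) :
    fam S X Γ ⟶ (modelMonad M).X.obj (extList X Γ) := fun _ => ↾(eval M)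

/-- Naturality of the unit handles variables, naturality of the action handles operations. -/
lemma eval_ren {t : S.ty} (x : Term S X Γ t) : ∀ {Δ : List (Word S.ty)}
    (f : extList X Γ ⟶ extList Y Δ), eval M (ren f x) = (modelMonad M).X.map f t (eval M x) := by
  induction x with
  | @var Γ t x => exact fun f => ctx_congr (unitAt_naturality (modelMonad M) f) t x
  | @op Γ t i a e ih =>
    intro Δ f
    refine Eq.trans ?_ (ctx_congr (modelOp_naturality M f) t ⟨i, fun k => eval M (a k), e⟩)
    refine congrArg (fun b => modelOp M (extList Y Δ) t ⟨i, b, e⟩) (funext fun k => ?_)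
    exact ih k _

/-- Links the syntactic lift to the semantic one: `strength` sends old variables through weakening,
which is `eval_ren`, and new ones to the unit. -/
lemma liftSub_evalHom (w : Word S.ty) (σ : extList X Γ ⟶ fam S Y Δ) :
    liftSub w σ ≫ evalHom M Y (w :: Δ) =
      (ext w).map (σ ≫ evalHom M Y Δ) ≫ strength (modelMonad M) w (extList Y Δ) :=
  liftSub_ext (fun t x => eval_ren M (Δ := w :: Δ) (σ t x) (inlHom w (extList Y Δ)))
    (fun t b => rfl)

/-- Evaluation turns substitution into the multiplication of the monad. The variable case is a unit
law; the operation case is linearity of the action combined with `liftSub_evalHom`. -/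
lemma eval_sub {t : S.ty} (x : Term S X Γ t) : ∀ {Δ : List (Word S.ty)}
    (σ : extList X Γ ⟶ fam S Y Δ), eval M (sub σ x) =
      multAt (modelMonad M) (extList Y Δ) t
        ((modelMonad M).X.map (σ ≫ evalHom M Y Δ) t (eval M x)) := by
  induction x with
  | @var Γ t x =>
    intro Δ σ
    have h := unitAt_naturality (modelMonad M) (σ ≫ evalHom M Y Δ)
    have h' : σ ≫ evalHom M Y Δ = unitAt (modelMonad M) (extList X Γ) ≫
        (modelMonad M).X.map (σ ≫ evalHom M Y Δ) ≫ multAt (modelMonad M) (extList Y Δ) := by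
      rw [← reassoc_of% h, unitAt_multAt, Category.comp_id]
    exact ctx_congr h' t x
  | @op Γ t i a e ih =>
    intro Δ σ
    have h := congrArg (multAt (modelMonad M) (extList Y Δ) t)
      (ctx_congr (modelOp_naturality M (σ ≫ evalHom M Y Δ)) t ⟨i, fun k => eval M (a k), e⟩)
    refine Eq.trans ?_ h
    -- Linearity moves the multiplication inside the operation, leaving one equation per argument.
    refine Eq.trans ?_ (ctx_congr (modelOp_linear M (extList Y Δ)) t _)
    refine congrArg (fun b => modelOp M (extList Y Δ) t ⟨i, b, e⟩) (funext fun k => ?_)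
    refine (ih k (liftSub _ σ)).trans ?_
    have h' (w : Word S.ty) : (modelMonad M).X.map (liftSub w σ ≫ evalHom M Y (w :: Δ)) ≫
          multAt (modelMonad M) (extList Y (w :: Δ)) =
        (modelMonad M).X.map ((ext w).map (σ ≫ evalHom M Y Δ)) ≫
          (modelMonad M).X.map (strength (modelMonad M) w (extList Y Δ)) ≫
            multAt (modelMonad M) ((ext w).obj (extList Y Δ)) := by
      rw [liftSub_evalHom]
      exact ((modelMonad M).X.map_comp_assoc _ _ _)
    exact ctx_congr (h' _) _ (eval M (a k))

end Term

/-- The interpretation of terms as a morphism of monads. -/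
def termMonHom : termMon S ⟶ modelMonad M where
  hom :=
    { app X := Term.evalHom M X []
      naturality X Y f := ctx_ext fun _ x => Term.eval_ren M (Y := Y) (Δ := []) x f }
  isMonHom_hom :=
    { one_hom := NatTrans.ext (funext fun X => rfl)
      -- Multiplication of terms is substitution along the identity, so this is `eval_sub` there.
      mul_hom := NatTrans.ext (funext fun X => ctx_ext fun t x =>
        (Term.eval_sub M (Y := X) (Δ := []) x (𝟙 (Term.fam S X []))).trans
          (ctx_congr (congrArg (fun h => (modelMonad M).X.map h ≫ multAt (modelMonad M) X)
            (Category.id_comp (Term.evalHom M X []))) t (Term.eval M (Γ := []) x))) }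

/-- The interpretation of terms as a morphism of models. -/
def termModelHom : termModel S ⟶ M where
  hom := termMonHom M
  -- `termOp` re-indexes its arguments by an identity renaming, which evaluation does not see.
  comm := NatTrans.ext (funext fun X => ctx_ext fun t x =>
    congrArg (fun b => modelOp M X t ⟨x.1, b, x.2.2⟩) (funext fun k =>
      (Term.eval_ren M (Y := X) (Δ := [_]) (x.2.1 k) _).trans
        (ctx_congr ((modelMonad M).X.map_id ((ext _).obj X)) _ (Term.eval M (Γ := []) (x.2.1 k)))))

variable {M}

/-- The components of a morphism of models from the model of terms. -/
def termHomApp (f : termModel S ⟶ M) (X : Ctx S.ty) :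
    Term.fam S X [] ⟶ (modelMonad M).X.obj X :=
  (f.hom.hom : termFunctor S ⟶ (modelMonad M).X).app X

lemma termHomApp_var (f : termModel S ⟶ M) (X : Ctx S.ty) :
    Term.varHom S X [] ≫ termHomApp f X = unitAt (modelMonad M) X :=
  unitAt_hom (R := termMon S) (R' := modelMonad M) f.hom X

lemma termHomApp_op (f : termModel S ⟶ M) (X : Ctx S.ty) :
    termOp S X ≫ termHomApp f X =
      opsMap S (fun w => termHomApp f ((ext w).obj X)) ≫ modelOp M X :=
  congrArg (fun (a : sigObj S (termFunctor S) ⟶ (modelMonad M).X) => NatTrans.app a X) f.comm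

/-- `f` only acts on terms with empty list, whereas induction passes under binders. A term over `Γ`
is therefore first moved to the family `extList X Γ`. -/
lemma termHomApp_eq_eval (f : termModel S ⟶ M) {X : Ctx S.ty} {Γ : List (Word S.ty)} {t : S.ty}
    (x : Term S X Γ t) :
    termHomApp f (extList X Γ) t (Term.ren (Y := extList X Γ) (Δ := []) (𝟙 (extList X Γ)) x) =
      Term.eval M x := by
  induction x with
  | @var Γ t x => exact ctx_congr (termHomApp_var f (extList X Γ)) t x
  | @op Γ t i a e ih =>
    have h := ctx_congr (termHomApp_op f (extList X Γ)) t ⟨i, fun k =>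
      Term.ren (Y := extList X (_ :: Γ)) (Δ := []) (𝟙 (extList X (_ :: Γ))) (a k), e⟩
    refine Eq.trans ?_ (h.trans (congrArg (fun b => modelOp M (extList X Γ) t ⟨i, b, e⟩)
      (funext ih)))
    refine congrArg (fun b => termHomApp f (extList X Γ) t (Term.op i b e)) (funext fun k => ?_)
    -- All the renamings involved are identities; they differ only in how bound words are split
    -- between family and list.
    refine Eq.trans ?_ (Term.ren_ren (Y := extList X (_ :: Γ)) (Z := extList X Γ) (Δ := [])
      (Θ := [_]) (a k) _ _).symm
    refine congrArg (fun g => Term.ren (Y := extList X Γ) (Δ := [_]) g (a k)) ?_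
    exact (Term.liftRen_id (X := X) (Γ := Γ) _).trans (Category.comp_id _).symm

lemma termModel_hom_unique (f : termModel S ⟶ M) : f = termModelHom M :=
  ModuleSignature.Model.hom_ext (NatTrans.ext (funext fun X => ctx_ext fun t x =>
    (congrArg (termHomApp f X t) (Term.ren_id (Γ := []) x).symm).trans
      (termHomApp_eq_eval f (Γ := []) x)))

/-- The model of terms is initial. -/
def termModelIsInitial (S : STSig.{u}) : Limits.IsInitial (termModel S) :=
  Limits.IsInitial.ofUniqueHom (fun M => termModelHom M) (fun _ f => termModel_hom_unique f)

end Initiality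
-- Strictification of a pseudofunctor to `Cat`.
section Strictification

open Bicategory

universe v₁ v₂

/-- Morphisms of formal images are pushed by conjugation with `pushIso`; this and `conj_map_comp`
are the functoriality of that operation. -/
lemma conj_map_id {C D : Type*} [Category* C] [Category* D] (F : C ⥤ D) {X : C} {X' : D}
    (i : X' ≅ F.obj X) : i.hom ≫ F.map (𝟙 X) ≫ i.inv = 𝟙 X' := by simp

lemma conj_map_comp {C D : Type*} [Category* C] [Category* D] (F : C ⥤ D) {X Y Z : C}
    {X' Y' Z' : D} (i : X' ≅ F.obj X) (j : Y' ≅ F.obj Y) (k : Z' ≅ F.obj Z)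
    (f : X ⟶ Y) (g : Y ⟶ Z) :
    i.hom ≫ F.map (f ≫ g) ≫ k.inv =
      (i.hom ≫ F.map f ≫ j.inv) ≫ j.hom ≫ F.map g ≫ k.inv := by simp

/-- Naturality of `m.inv`; it is the morphism part of `push_id`. -/
lemma conj_map_eq_self {C : Type*} [Category* C] {F : C ⥤ C} (m : F ≅ 𝟭 C) {X Y : C}
    {i : X ≅ F.obj X} {j : Y ≅ F.obj Y} (hi : i.hom = m.inv.app X) (hj : j.hom = m.inv.app Y)
    (f : X ⟶ Y) : i.hom ≫ F.map f ≫ j.inv = f := by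
  rw [← Category.assoc, Iso.comp_inv_eq, hi, hj]
  exact (m.inv.naturality f).symm

/-- Conjugating in one step or in two agrees once the isomorphisms cohere at both endpoints. In
`push_comp` that coherence is `pushIso_comp`. -/
lemma conj_map_eq_conj_map {C D E : Type*} [Category* C] [Category* D] [Category* E] {F : C ⥤ D}
    {K : D ⥤ E} {H : C ⥤ E} (m : H ≅ F ⋙ K) {X Y : C} {X₁ Y₁ : D} {X₂ Y₂ : E}
    {i : X₂ ≅ H.obj X} {j : X₂ ≅ K.obj X₁} {k : X₁ ≅ F.obj X}
    {i' : Y₂ ≅ H.obj Y} {j' : Y₂ ≅ K.obj Y₁} {k' : Y₁ ≅ F.obj Y}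
    (h : i.hom ≫ m.hom.app X = j.hom ≫ K.map k.hom)
    (h' : i'.hom ≫ m.hom.app Y = j'.hom ≫ K.map k'.hom) (f : X ⟶ Y) :
    i.hom ≫ H.map f ≫ i'.inv = j.hom ≫ K.map (k.hom ≫ F.map f ≫ k'.inv) ≫ j'.inv := by
  have h₁ : i'.inv ≫ j'.hom ≫ K.map k'.hom = m.hom.app Y := by simp [← h']
  have h₂ : i'.inv = m.hom.app Y ≫ K.map k'.inv ≫ j'.inv := by
    rw [← h₁]
    simp [← K.map_comp_assoc]
  rw [h₂, m.hom.naturality_assoc, reassoc_of% h]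
  simp

variable {I : Type (v₁ + 1)} [LargeCategory I] (G : LocallyDiscrete I ⥤ᵖ Cat.{v₂, v₁ + 1})

/-- An object over `b` of the strictification of a pseudofunctor `G`: a formal image under a
morphism with target `b` of an object of a value of `G`. -/
structure FormalImage (b : LocallyDiscrete I) : Type (v₁ + 1) where
  src : LocallyDiscrete I
  hom : src ⟶ b
  obj : G.obj src

namespace FormalImage

variable {G} {a b c : LocallyDiscrete I}

/-- The actual image. -/
def eval (A : FormalImage G b) : G.obj b := (G.map A.hom).toFunctor.obj A.obj

/-- Morphisms of formal images are morphisms of the actual images. -/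
instance (b : LocallyDiscrete I) : Category.{v₂} (FormalImage G b) where
  Hom A B := A.eval ⟶ B.eval
  id A := 𝟙 A.eval
  comp f g := CategoryStruct.comp (obj := G.obj b) f g
  id_comp f := Category.id_comp (obj := G.obj b) f
  comp_id f := Category.comp_id (obj := G.obj b) f
  assoc f g h := Category.assoc (obj := G.obj b) f g h

variable (G b) in
/-- Evaluation of formal images. -/
def evalFunctor : FormalImage G b ⥤ G.obj b where
  obj := eval
  map f := f

/-- Full faithfulness is built into the morphisms; `X` is reached, up to `G.mapId b`, from its
formal image under `𝟙 b`. -/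
instance : (evalFunctor G b).IsEquivalence where
  faithful := ⟨fun h => h⟩
  full := ⟨fun f => ⟨f, rfl⟩⟩
  essSurj := ⟨fun X => ⟨⟨b, 𝟙 b, X⟩, ⟨(Cat.Hom.toNatIso (G.mapId b)).app X⟩⟩⟩

/-- The image under `h` of a formal image, where `c` computes composition with `h`. -/
def pushObj (c : ∀ s : LocallyDiscrete I, (s ⟶ a) → (s ⟶ b)) (A : FormalImage G a) :
    FormalImage G b := ⟨A.src, c _ A.hom, A.obj⟩

/-- The actual image of a pushed formal image. -/
def pushIso (h : a ⟶ b) {c : ∀ s : LocallyDiscrete I, (s ⟶ a) → (s ⟶ b)}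
    (hc : ∀ s f, f ≫ h = c s f) (A : FormalImage G a) :
    (pushObj c A).eval ≅ (G.map h).toFunctor.obj A.eval :=
  (Cat.Hom.toNatIso (G.mapComp' A.hom h _ (hc _ _))).app A.obj

/-- The functoriality of formal images. -/
def push (h : a ⟶ b) (c : ∀ s : LocallyDiscrete I, (s ⟶ a) → (s ⟶ b))
    (hc : ∀ s f, f ≫ h = c s f) : FormalImage G a ⥤ FormalImage G b where
  obj := pushObj c
  map {A B} φ := CategoryStruct.comp (obj := G.obj b) (pushIso h hc A).hom
    ((G.map h).toFunctor.map ((evalFunctor G a).map φ) ≫ (pushIso h hc B).inv)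
  map_id A := conj_map_id (G.map h).toFunctor (pushIso h hc A)
  map_comp {A B C} φ ψ := conj_map_comp (G.map h).toFunctor (pushIso h hc A) (pushIso h hc B)
    (pushIso h hc C) ((evalFunctor G a).map φ) ((evalFunctor G a).map ψ)

/-- Associativity coherence of `G` at `A.hom`, `h`, `k`. Composition with `h ≫ k` is bracketed as
`(f ≫ h) ≫ k` so that both sides start at the same formal image. -/
lemma pushIso_comp (h : a ⟶ b) (k : b ⟶ c) (A : FormalImage G a) :
    (pushIso (h ≫ k) (c := fun _ f => (f ≫ h) ≫ k)
        (fun _ f => (Category.assoc f h k).symm) A).hom ≫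
      (G.mapComp h k).hom.toNatTrans.app A.eval =
    (pushIso k (fun _ _ => rfl) (pushObj (fun _ f => f ≫ h) A)).hom ≫
      (G.map k).toFunctor.map (pushIso h (fun _ _ => rfl) A).hom := by
  have hA := G.mapComp'₀₁₃_hom_comp_whiskerLeft_mapComp'_hom_app A.hom h k _ _
    ((A.hom ≫ h) ≫ k) rfl rfl (Category.assoc _ _ _).symm A.obj
  rw [G.mapComp'_eq_mapComp h k] at hA
  exact hA

/-- Composition with `h` is a parameter `c` so that functors to be compared can have definitionally
equal object maps, with no transport of morphisms. This lemma changes `c`. -/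
lemma push_congr {h : a ⟶ b} {c c' : ∀ s : LocallyDiscrete I, (s ⟶ a) → (s ⟶ b)}
    (hc : ∀ s f, f ≫ h = c s f) (hc' : ∀ s f, f ≫ h = c' s f) :
    push (G := G) h c hc = push h c' hc' := by
  obtain rfl : c = c' := funext fun s => funext fun f => (hc s f).symm.trans (hc' s f)
  rfl

/-- Right unit coherence of `G`; taking `c` to be the identity makes the source `A` itself. -/
lemma pushIso_id (A : FormalImage G a) :
    (pushIso (𝟙 a) (c := fun _ f => f) (fun _ f => Category.comp_id f) A).hom =
      (G.mapId a).inv.toNatTrans.app A.eval :=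
  G.mapComp'_comp_id_hom_app A.hom A.obj

lemma push_id : push (G := G) (𝟙 a) (fun _ f => f) (fun _ f => Category.comp_id f) = 𝟭 _ :=
  CategoryTheory.Functor.hext (fun _ => rfl) (fun A B φ => heq_of_eq
    (conj_map_eq_self (Cat.Hom.toNatIso (G.mapId a)) (pushIso_id A) (pushIso_id B)
      ((evalFunctor G a).map φ)))

lemma push_comp (h : a ⟶ b) (k : b ⟶ c) :
    push (G := G) (h ≫ k) (fun _ f => (f ≫ h) ≫ k) (fun _ f => (Category.assoc f h k).symm) =
      push h (fun _ f => f ≫ h) (fun _ _ => rfl) ⋙ push k (fun _ f => f ≫ k) (fun _ _ => rfl) :=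
  CategoryTheory.Functor.hext (fun _ => rfl) (fun A B φ => heq_of_eq
    (conj_map_eq_conj_map (Cat.Hom.toNatIso (G.mapComp h k)) (pushIso_comp h k A)
      (pushIso_comp h k B) ((evalFunctor G a).map φ)))

/-- A component remembers its source, so changing `c` costs an `eqToHom`. It will match the
structure isomorphisms of the strict functor in `strictifyEval`. -/
lemma pushIso_congr (h : a ⟶ b) {c c' : ∀ s : LocallyDiscrete I, (s ⟶ a) → (s ⟶ b)}
    (hc : ∀ s f, f ≫ h = c s f) (hc' : ∀ s f, f ≫ h = c' s f) (A : FormalImage G a)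
    (e : pushObj c A = pushObj c' A) :
    (pushIso h hc A).hom = (evalFunctor G b).map (eqToHom e) ≫ (pushIso h hc' A).hom := by
  obtain rfl : c = c' := funext fun s => funext fun f => (hc s f).symm.trans (hc' s f)
  exact (Category.id_comp _).symm

end FormalImage

/-- The strict functor equivalent to a pseudofunctor. -/
def strictify : I ⥤ Cat.{v₂, v₁ + 1} where
  obj i := Cat.of (FormalImage G ⟨i⟩)
  map f := (FormalImage.push f.toLoc (fun _ g => g ≫ f.toLoc) (fun _ _ => rfl)).toCatHom
  map_id i := Cat.ext ((FormalImage.push_congr (fun _ _ => rfl) _).trans FormalImage.push_id)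
  map_comp f g := Cat.ext ((FormalImage.push_congr (fun _ _ => rfl) _).trans
    (FormalImage.push_comp f.toLoc g.toLoc))

/-- The evaluation of formal images as a pseudonatural transformation. -/
def strictifyEval : Pseudofunctor.StrongTrans (strictify G).toPseudofunctor' G where
  app b := (FormalImage.evalFunctor G b).toCatHom
  naturality {a b} f := Cat.Hom.isoMk (NatIso.ofComponents
    (fun A => FormalImage.pushIso f (fun _ _ => rfl) A) (fun {A B} φ => by
      have h : ∀ {X Y : G.obj b} {X' Y' : G.obj b} (i : X' ≅ X) (j : Y' ≅ Y) (g : X ⟶ Y),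
        (i.hom ≫ g ≫ j.inv) ≫ j.hom = i.hom ≫ g := by simp
      exact h _ _ _))
  naturality_naturality {a b f g} η := by
    -- The source is locally discrete, so its only 2-cells are identities.
    obtain rfl := LocallyDiscrete.eq_of_hom η
    obtain rfl : η = 𝟙 f := Subsingleton.elim _ _
    rw [PrelaxFunctor.map₂_id, PrelaxFunctor.map₂_id]
    exact (congrArg (· ≫ _) (Bicategory.id_whiskerRight _ _)).trans ((Category.id_comp _).trans
      ((congrArg (_ ≫ ·) (Bicategory.whiskerLeft_id _ _)).trans (Category.comp_id _)).symm)
  naturality_id a := Cat.Hom₂.ext (NatTrans.ext (funext fun A => by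
    have e : FormalImage.pushObj (fun _ f => f ≫ 𝟙 a) A = A :=
      congrArg (FormalImage.mk A.src · A.obj) (Category.comp_id A.hom)
    have h₁ := FormalImage.pushIso_congr (𝟙 a) (fun _ _ => rfl) (fun _ f => Category.comp_id f) A e
    have h₂ : (FormalImage.pushIso (𝟙 a) (c := fun _ f => f) (fun _ f => Category.comp_id f) A).hom
        ≫ (G.mapId a).hom.toNatTrans.app A.eval = 𝟙 _ :=
      (congrArg (· ≫ _) (FormalImage.pushIso_id A)).trans
        (Cat.Hom.inv_hom_id_toNatTrans_app _ _)
    -- The unit isomorphism of a strict functor is an `eqToHom`, the one that appears in `h₁`.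
    have h₃ : @Eq (FormalImage.pushObj (fun _ f => f ≫ 𝟙 a) A ⟶ A)
        (((strictify G).toPseudofunctor'.mapId a).hom.toNatTrans.app A) (eqToHom e) :=
      Cat.eqToHom_app _ _ ((strictify G).map_id a.as) A
    refine (congrArg (· ≫ _) h₁).trans ((Category.assoc _ _ _).trans
      ((congrArg (_ ≫ ·) h₂).trans ?_))
    exact congrArg₂ (· ≫ ·) (congrArg _ h₃.symm) (Category.id_comp _).symm))
  naturality_comp {a b c} f g := Cat.Hom₂.ext (NatTrans.ext (funext fun A => by
    -- The two bracketings give formal images that are equal but not syntactically so; past the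
    -- resulting `eqToHom` the claim is `pushIso_comp`.
    have e : FormalImage.pushObj (fun _ k => k ≫ f ≫ g) A =
        FormalImage.pushObj (fun _ k => (k ≫ f) ≫ g) A :=
      congrArg (FormalImage.mk A.src · A.obj) (Category.assoc A.hom f g).symm
    have h₁ := FormalImage.pushIso_congr (f ≫ g) (fun _ _ => rfl)
      (fun _ k => (Category.assoc k f g).symm) A e
    have h₂ := FormalImage.pushIso_comp f g A
    have h₃ : @Eq (FormalImage.pushObj (fun _ k => k ≫ f ≫ g) A ⟶
          FormalImage.pushObj (fun _ k => (k ≫ f) ≫ g) A)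
        (((strictify G).toPseudofunctor'.mapComp f g).hom.toNatTrans.app A) (eqToHom e) :=
      Cat.eqToHom_app _ _ ((strictify G).map_comp f.as g.as) A
    have h₄ : ∀ {X₁ X₂ X₃ X₄ : G.obj c} (i : X₁ ⟶ X₂) (j : X₂ ⟶ X₃) (k : X₃ ⟶ X₄),
      i ≫ j ≫ k = i ≫ 𝟙 _ ≫ j ≫ 𝟙 _ ≫ k ≫ 𝟙 _ := by simp
    refine (congrArg (· ≫ _) h₁).trans ((Category.assoc _ _ _).trans
      ((congrArg (_ ≫ ·) h₂).trans ?_))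
    exact (congrArg (fun k => (FormalImage.evalFunctor G c).map k ≫ _) h₃.symm).trans
      (h₄ _ _ _)))

end Strictification
end InitSem

/-! ### Assembly of the two constructions. -/

theorem mainTheorem3 :
    (∃ (F : InitSem.STSig.{u}ᵒᵖ ⥤ Cat.{u + 1, u + 1})
        (η : Pseudofunctor.StrongTrans F.toPseudofunctor' InitSem.STSigModel.{u}),
        ∀ S : LocallyDiscrete InitSem.STSig.{u}ᵒᵖ, (η.app S).toFunctor.IsEquivalence) ∧
      ∀ S : InitSem.STSig.{u},
        InitSem.STSigModel.{u}.obj ⟨Opposite.op S⟩ = Cat.of S.toModSig.Model ∧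
          Limits.HasInitial (InitSem.STSigModel.{u}.obj ⟨Opposite.op S⟩) := by
  refine ⟨⟨InitSem.strictify InitSem.STSigModel.{u}, InitSem.strictifyEval _, fun S =>
    inferInstanceAs (InitSem.FormalImage.evalFunctor InitSem.STSigModel.{u} S).IsEquivalence⟩,
    -- The composite pseudofunctor takes the category of models as its value by definition.
    fun S => ⟨rfl, (InitSem.termModelIsInitial S).hasInitial⟩⟩
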